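/- **Setting.** Fix a floating-point format: a base $b\ge 2$, a precision $p\ge 1$, a minimal exponent $e_{\min}$. A float is a pair of integers $(m,e)$ with $|m|<b^p$ and $-e_{\min}\le e$; it represents the real number $R(m,e)=m\,b^e$. Fix a rounding $\mathrm{rnd}$ of real numbers to a closest float, and a set of operations $\odot$ on the reals, each with a floating-point counterpart $\tilde\odot$ and an error bound function $\epsilon_{\tilde\odot}$ such that $|R(\tilde v_i)-r_i|\le e_i$ for all $i$ implies $|R(\tilde\odot(\tilde v_i)_i)-\odot(r_i)_i|\le\epsilon_{\tilde\odot}(r_i,e_i)_i$. *Programs.* Arithmetic expressions $A$ are built from constants, variables, operations and function calls. Guards $B$ are built from true, false and sign tests $A\diamond 0$, $\diamond\in\{<,\le,>,\ge\}$, by $\wedge,\vee,\neg$ (a comparison $a<b$ is written $a-b<0$). Program expressions $S$ are: arithmetic expressions, $\mathit{let}\ x=A\ \mathit{in}\ S$, conditionals $\mathit{if}\ B_1\ \mathit{then}\ S_1\ [\mathit{elsif}\ B_i\ \mathit{then}\ S_i]_i\ \mathit{else}\ S_n$ with $n\ge2$, and bounded loops $\mathit{for}(i_0,i_N,\mathit{acc}_0,\lambda(i,\mathit{acc}).S)$.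 A real program $P$ is a finite sequence of declarations $f(x_1,\dots,x_n)=S$ of distinct functions, where the $x_i$ are distinct, the free variables of $S$ are among them, and only previously declared functions are called. $F(P)$ is its floating-point version: constants $d$ become the floats $\tilde d=\mathrm{rnd}(d)$ representing them (so do the values of loop indices), operations $\odot$ become $\tilde\odot$, and $x$, $f$ become $\tilde x$, $\tilde f$. Conversely, $R(\cdot)$ gives back the real expression that a floating-point expression represents. *Semantics of $F(P)$.* A conditional error bound is a tuple $\langle\eta,\tilde\eta\rangle\twoheadrightarrow(r,\tilde v,e)_t$: a real and a float path condition, a real and a float symbolic result, a symbolic error bound, and a flag $t\in\{\mathbf s,\mathbf u\}$ (stable, unstable). To every expression a set of such tuples is associated: - a constant $\tilde d$ representing $d$: $\langle\mathrm{true},\mathrm{true}\rangle\twoheadrightarrow(d,\tilde d,|d-R(\tilde d)|)_{\mathbf s}$; a parameter $\tilde x$: $\langle\mathrm{true},\mathrm{true}\rangle\twoheadrightarrow(x,\tilde x,\chi_e(\tilde x))_{\mathbf s}$, where $\chi_e(\tilde x)$ stands for the error of $\tilde x$; - $\tilde\odot(\tilde A_i)_i$: for all choices of a tuple for each $\tilde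 A_i$, the conjunction of the conditions, the results $\odot(r_i)_i$ and $\tilde\odot(\tilde v_i)_i$, and the error $\epsilon_{\tilde\odot}(r_i,e_i)_i$; - a call $\tilde g(\tilde A_i)_i$: for all choices of a tuple of $\tilde g$ and of a tuple for each $\tilde A_i$, the tuple of $\tilde g$ in which the real value, the float value and the error of the $i$-th parameter are replaced by $r_i,\tilde v_i,e_i$, with the conditions of the arguments added; a let-in expression is the application of $\lambda x.S$ to $A$, and a loop is the iterated application of $\lambda(i,\mathit{acc}).S$ for $i=i_0,\dots,i_N$, starting from $\mathit{acc}_0$; - a conditional: every tuple of a branch $S_i$, with the added conditions that the real and the float flow both take branch $i$; and, for $i\ne j$ and stable tuples of $S_i$ and $S_j$, an unstable tuple with the real condition and result of $S_i$ and the float condition and result of $S_j$, the error $e_j+|r_i-r_j|$, and the added conditions that the real flow takes branch $i$ and the float flow takes branch $j$. A tuple composed from others is unstable if one of these is; compound tuples with an unsatisfiable conjunction $\eta\wedge\tilde\eta$ are dropped. The semantics of $F(P)$ is the least fixed point of the operator that, given sets of tuples for the functions, assigns to each $\tilde f$ the semantics of its body. *Transformation.* To every floating-point arithmetic expression $\tilde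 A$ an error variable $\epsilon_{\mathrm{var}}(\tilde A)$ is associated. The abstractions $\beta^\pm$ of guards are defined by $\beta^+(\tilde A\le0)=(\tilde A\le-\epsilon)$, $\beta^-(\tilde A\le0)=(\tilde A>\epsilon)$, $\beta^+(\tilde A\ge0)=(\tilde A\ge\epsilon)$, $\beta^-(\tilde A\ge0)=(\tilde A<-\epsilon)$, $\beta^+(\tilde A<0)=(\tilde A<-\epsilon)$, $\beta^-(\tilde A<0)=(\tilde A\ge\epsilon)$, $\beta^+(\tilde A>0)=(\tilde A>\epsilon)$, $\beta^-(\tilde A>0)=(\tilde A\le-\epsilon)$ with $\epsilon=\epsilon_{\mathrm{var}}(\tilde A)$; $\beta^+$ commutes with $\wedge,\vee$ and fixes true and false; $\beta^-$ exchanges $\wedge$ with $\vee$ and true with false; $\beta^\pm(\neg\phi)=\beta^\mp(\phi)$. For each declaration $\tilde f(\tilde x_1,\dots,\tilde x_n)=\tilde S$ of $F(P)$, the transformed program $\bar\tau(P)$ has the declaration $\tilde f^\tau(\tilde x_1,\dots,\tilde x_n,e_1,\dots,e_m)=\tau(\tilde S)$, where $e_1,\dots,e_m$ are the error variables introduced by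 $\tau$ and $\omega$ denotes a warning: $\tau$ leaves constants and variables unchanged; an operation or call first tests whether one of its transformed arguments is $\omega$, and returns $\omega$ in this case; in a call, $\tilde g$ becomes $\tilde g^\tau$, and its error parameter $\epsilon_{\mathrm{var}}(\tilde A)$ is instantiated with $\epsilon_{\mathrm{var}}$ of $\tilde A$ with the actual for the formal parameters; $\mathit{let}\ x=\tilde A\ \mathit{in}\ \tilde S$ tests in the same way whether $\tau(\tilde A)=\omega$; in loops, the body is transformed; a conditional keeps its tests, with transformed expressions and branches, if each of its guards satisfies $\tilde\phi\Leftrightarrow\beta^+(\tilde\phi)$ and $\neg\tilde\phi\Leftrightarrow\beta^-(\tilde\phi)$, and otherwise becomes: return $\omega$ if an arithmetic expression in a guard is $\omega$, else $\tau(\tilde S_i)$ for the first $i<n$ with $\beta^+(\tilde\phi_i)\wedge\bigwedge_{j<i}\beta^-(\tilde\phi_j)$, else $\tau(\tilde S_n)$ if $\bigwedge_{j<n}\beta^-(\tilde\phi_j)$, else $\omega$ (with all arithmetic expressions in the guards transformed). The warning is exceptional: every construct propagates it, except for the test whether an expression is $\omega$. **Theorem (Program Transformation Correctness).** Let $P$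 be a real program, $f(x_1,\dots,x_n)=S$ a declaration of $P$, and $\tilde f^\tau(\tilde x_1,\dots,\tilde x_n,e_1,\dots,e_m)$ its transformed floating-point version in $\bar\tau(P)$. Let $\sigma:\{x_1,\dots,x_n\}\to\mathbb R$ and $\tilde\sigma:\{\tilde x_1,\dots,\tilde x_n\}\to\mathbb F$ be such that $R(\tilde\sigma(\tilde x_i))=\sigma(x_i)$ for all $i$. Let $\chi_e(\tilde x_i)\ge|R(\tilde\sigma(\tilde x_i))-\sigma(x_i)|$ be any bounds for the input errors. Let the error variables have float values that bound the errors they stand for: the value of $\epsilon_{\mathrm{var}}(\tilde A)$ is at least $|\tilde A-R(\tilde A)|$ for each arithmetic expression $\tilde A$ whose test is abstracted in the body of $\tilde f$ (in all branches, in the bodies of the functions called, and for all values that the local variables take in real and in floating-point arithmetic). Then $$\tilde f^\tau(\tilde x_1,\dots,\tilde x_n,e_1,\dots,e_m)\ne\omega\iff|f(x_1,\dots,x_n)-\tilde f^\tau(\tilde x_1,\dots,\tilde x_n,e_1,\dots,e_m)|\le e_{\tilde f},$$ where $e_{\tilde f}$ is the maximum of the values, at $\sigma$ and $\chi_e$,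 of the errors $e$ of the stable tuples $\langle\eta,\tilde\eta\rangle\twoheadrightarrow(r,\tilde v,e)_{\mathbf s}$ in the semantics of $\tilde f$ in $F(P)$. The right-hand side asserts that this maximum exists, that $\tilde f^\tau$ returns a float, and that the inequality holds; it is false when the result is $\omega$. -/

import Mathlib

namespace FPTrans

/-! ## Floating-point numbers -/

/-- A floating-point format: a base `b ≥ 2`, a precision `p ≥ 1` and a minimal exponent. -/
structure Format where
  base : ℕ
  prec : ℕ
  emin : ℤ
  two_le_base : 2 ≤ base
  one_le_prec : 1 ≤ prec

/-- A float of the format: a pair `(m, e)` of integers with `|m| < b ^ p` and `-emin ≤ e`. -/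
structure Float (φ : Format) where
  m : ℤ
  e : ℤ
  m_lt : |m| < (φ.base : ℤ) ^ φ.prec
  e_le : -φ.emin ≤ e

/-- The real number `m * b ^ e` represented by a float. -/
noncomputable def Float.toReal {φ : Format} (x : Float φ) : ℝ :=
  (x.m : ℝ) * (φ.base : ℝ) ^ x.e

/-- The float `0`; it only serves as the (never used) value of variables out of scope. -/
def Float.zero (φ : Format) : Float φ where
  m := 0
  e := -φ.emin
  m_lt := by
    have h := φ.two_le_base
    have : (0 : ℤ) < φ.base := by omega
    simpa using pow_pos this φ.prec
  e_le := le_refl _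

/-- `rnd` rounds every real number to a closest float (ties are broken arbitrarily). -/
def IsRounding {φ : Format} (rnd : ℝ → Float φ) : Prop :=
  ∀ (r : ℝ) (x : Float φ), |(rnd r).toReal - r| ≤ |x.toReal - r|

/-- The pre-defined operations: each symbol has an arity, a real-valued operation, its
floating-point counterpart, and an accumulated-error bound function for the latter. -/
structure Ops (φ : Format) where
  Op : Type
  arity : Op → ℕ
  real : (o : Op) → (Fin (arity o) → ℝ) → ℝ
  flt : (o : Op) → (Fin (arity o) → Float φ) → Float φ
  bound : (o : Op) → (Fin (arity o) → ℝ) → (Fin (arity o) → ℝ) → ℝ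
  bound_sound : ∀ (o : Op) (v : Fin (arity o) → Float φ) (r e : Fin (arity o) → ℝ),
    (∀ i, |(v i).toReal - r i| ≤ e i) → |(flt o v).toReal - real o r| ≤ bound o r e

/-! ## Grammar

One grammar is used for real programs (`C = ℝ`) and for their floating-point versions
(`C = FConst φ`).  A real variable `x` and the float variable `x̃` with `χ_r(x̃) = x` share the
same name, and so do an operation (a function) and its floating-point counterpart. -/

/-- Names of variables. -/
abbrev Var := ℕ

/-- Names of functions. -/
abbrev FName := ℕ

/-- A floating-point constant, together with the real constant that it represents. -/
structure FConst (φ : Format) where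
  flt : Float φ
  real : ℝ

/-- The floating-point constant that represents the real constant `r`. -/
def roundConst {φ : Format} (rnd : ℝ → Float φ) (r : ℝ) : FConst φ := ⟨rnd r, r⟩

/-- Arithmetic expressions. -/
inductive AExp {φ : Format} (Ω : Ops φ) (C : Type) : Type
  | const (c : C)
  | var (x : Var)
  | op (o : Ω.Op) (args : Fin (Ω.arity o) → AExp Ω C)
  | call (f : FName) (n : ℕ) (args : Fin n → AExp Ω C)

/-- The four comparison symbols of sign tests. -/
inductive Cmp
  | lt | le | gt | ge

def Cmp.holds : Cmp → ℝ → ℝ → Prop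
  | .lt, a, b => a < b
  | .le, a, b => a ≤ b
  | .gt, a, b => a > b
  | .ge, a, b => a ≥ b

/-- Boolean expressions over sign tests `A ⋄ 0` (a comparison `a < b` is `a - b < 0`). -/
inductive BExp {φ : Format} (Ω : Ops φ) (C : Type) : Type
  | tt
  | ff
  | and (a b : BExp Ω C)
  | or (a b : BExp Ω C)
  | not (a : BExp Ω C)
  | sign (c : Cmp) (a : AExp Ω C)

/-- Program expressions without warnings.

* `cond m B S` is `if B 0 then S 0 elsif B 1 then S 1 … elsif B m then S m else S (m + 1)`; the
  binary conditional is the case `m = 0`.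
* `forLoop i₀ iN acc₀ i acc S` is `for (i₀, iN, acc₀, λ (i, acc). S)`. -/
inductive Stm {φ : Format} (Ω : Ops φ) (C : Type) : Type
  | arith (a : AExp Ω C)
  | letIn (x : Var) (a : AExp Ω C) (s : Stm Ω C)
  | cond (m : ℕ) (B : Fin (m + 1) → BExp Ω C) (S : Fin (m + 2) → Stm Ω C)
  | forLoop (i₀ iN : ℕ) (acc₀ : C) (i acc : Var) (s : Stm Ω C)

/-- A function declaration `f(x_1, …, x_n) = S`. -/
structure Decl {φ : Format} (Ω : Ops φ) (C : Type) where
  name : FName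
  arity : ℕ
  params : Fin arity → Var
  params_inj : Function.Injective params
  body : Stm Ω C

/-- A program: its declarations, listed from the last one to the first one. -/
abbrev Program {φ : Format} (Ω : Ops φ) (C : Type) := List (Decl Ω C)

section Grammar

variable {φ : Format} {Ω : Ops φ} {C D : Type}

/-- Replacement of constants. -/
def AExp.map (g : C → D) : AExp Ω C → AExp Ω D
  | .const c => .const (g c)
  | .var x => .var x
  | .op o args => .op o (fun i => (args i).map g)
  | .call f n args => .call f n (fun i => (args i).map g)

def BExp.map (g : C → D) : BExp Ω C → BExp Ω D
  | .tt => .tt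
  | .ff => .ff
  | .and a b => .and (a.map g) (b.map g)
  | .or a b => .or (a.map g) (b.map g)
  | .not a => .not (a.map g)
  | .sign c a => .sign c (a.map g)

def Stm.map (g : C → D) : Stm Ω C → Stm Ω D
  | .arith a => .arith (a.map g)
  | .letIn x a s => .letIn x (a.map g) (s.map g)
  | .cond m B S => .cond m (fun j => (B j).map g) (fun j => (S j).map g)
  | .forLoop i₀ iN acc₀ i acc s => .forLoop i₀ iN (g acc₀) i acc (s.map g)

def Decl.map (g : C → D) (d : Decl Ω C) : Decl Ω D where
  name := d.name
  arity := d.arity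
  params := d.params
  params_inj := d.params_inj
  body := d.body.map g

/-- `F(P)`: the straightforward floating-point version of a real program. -/
def toFloat (rnd : ℝ → Float φ) (P : Program Ω ℝ) : Program Ω (FConst φ) :=
  P.map (Decl.map (roundConst rnd))

/-- `R(A)`: the real counterpart of a floating-point arithmetic expression. -/
def AExp.toReal (a : AExp Ω (FConst φ)) : AExp Ω ℝ := a.map FConst.real

/-- `R(B)`: the real counterpart of a floating-point Boolean expression. -/
def BExp.toReal (b : BExp Ω (FConst φ)) : BExp Ω ℝ := b.map FConst.real

/-- `R(S)`: the real counterpart of a floating-point program expression. -/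
def Stm.toReal (s : Stm Ω (FConst φ)) : Stm Ω ℝ := s.map FConst.real

/-- `R(P)`: the real counterpart of a floating-point program. -/
def toReal (P : Program Ω (FConst φ)) : Program Ω ℝ := P.map (Decl.map FConst.real)

/-- Free variables. -/
def AExp.fv : AExp Ω C → Set Var
  | .const _ => ∅
  | .var x => {x}
  | .op _ args => ⋃ i, (args i).fv
  | .call _ _ args => ⋃ i, (args i).fv

def BExp.fv : BExp Ω C → Set Var
  | .tt => ∅
  | .ff => ∅
  | .and a b => a.fv ∪ b.fv
  | .or a b => a.fv ∪ b.fv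
  | .not a => a.fv
  | .sign _ a => a.fv

def Stm.fv : Stm Ω C → Set Var
  | .arith a => a.fv
  | .letIn x a s => a.fv ∪ (s.fv \ {x})
  | .cond _ B S => (⋃ j, (B j).fv) ∪ ⋃ j, (S j).fv
  | .forLoop _ _ _ i acc s => s.fv \ {i, acc}

/-- The functions (with the number of arguments) that are called. -/
def AExp.calls : AExp Ω C → Set (FName × ℕ)
  | .const _ => ∅
  | .var _ => ∅
  | .op _ args => ⋃ i, (args i).calls
  | .call f n args => {(f, n)} ∪ ⋃ i, (args i).calls

def BExp.calls : BExp Ω C → Set (FName × ℕ)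
  | .tt => ∅
  | .ff => ∅
  | .and a b => a.calls ∪ b.calls
  | .or a b => a.calls ∪ b.calls
  | .not a => a.calls
  | .sign _ a => a.calls

def Stm.calls : Stm Ω C → Set (FName × ℕ)
  | .arith a => a.calls
  | .letIn _ a s => a.calls ∪ s.calls
  | .cond _ B S => (⋃ j, (B j).calls) ∪ ⋃ j, (S j).calls
  | .forLoop _ _ _ _ _ s => s.calls

/-- The functions declared in a program. -/
def declared (P : Program Ω C) : Set (FName × ℕ) := {q | ∃ d ∈ P, q = (d.name, d.arity)}

/-- Well-formed programs: no function is declared twice, the free variables of a body are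
parameters, and every function that is called has been declared before. -/
def WellFormed : Program Ω C → Prop
  | [] => True
  | d :: P => (d.name, d.arity) ∉ declared P ∧ d.body.fv ⊆ Set.range d.params ∧
      d.body.calls ⊆ declared P ∧ WellFormed P

/-- The arithmetic expressions occurring in the sign tests of a Boolean expression. -/
def BExp.atoms : BExp Ω C → List (AExp Ω C)
  | .tt => []
  | .ff => []
  | .and a b => a.atoms ++ b.atoms
  | .or a b => a.atoms ++ b.atoms
  | .not a => a.atoms
  | .sign _ a => [a]

/-- Finite conjunctions. -/
def BExp.conj : List (BExp Ω C) → BExp Ω C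
  | [] => .tt
  | b :: l => .and b (BExp.conj l)

/-- The condition under which branch `i` of an n-ary conditional is taken: its guard holds (the
`else` branch has none) and no guard of a previous branch holds. -/
def branchCond {m : ℕ} (B : Fin (m + 1) → BExp Ω C) (i : Fin (m + 2)) : BExp Ω C :=
  .and (if h : (i : ℕ) < m + 1 then B ⟨i, h⟩ else .tt)
    (BExp.conj (((List.finRange (m + 1)).filter fun j : Fin (m + 1) => j.val < i.val).map fun j => .not (B j)))

/-- Simultaneous substitution of arithmetic expressions for variables. -/
def AExp.subst (θ : Var → AExp Ω C) : AExp Ω C → AExp Ω C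
  | .const c => .const c
  | .var x => θ x
  | .op o args => .op o (fun i => (args i).subst θ)
  | .call f n args => .call f n (fun i => (args i).subst θ)

def BExp.subst (θ : Var → AExp Ω C) : BExp Ω C → BExp Ω C
  | .tt => .tt
  | .ff => .ff
  | .and a b => .and (a.subst θ) (b.subst θ)
  | .or a b => .or (a.subst θ) (b.subst θ)
  | .not a => .not (a.subst θ)
  | .sign c a => .sign c (a.subst θ)

end Grammar

open Classical in
/-- The assignment `xs i ↦ vs i`, and `x ↦ dflt x` for all other variables. -/
noncomputable def assign {α : Type} {n : ℕ} (xs : Fin n → Var) (vs : Fin n → α) (dflt : Var → α) :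
    Var → α :=
  fun x => if h : ∃ i, xs i = x then vs h.choose else dflt x

/-- The assignment `σ` changed at the control variable and at the accumulator of a loop. -/
def bindLoop {α : Type} (σ : Var → α) (i acc : Var) (vi vacc : α) : Var → α :=
  Function.update (Function.update σ i vi) acc vacc

/-! ## Evaluation of real and floating-point programs -/

/-- What is needed to evaluate expressions with constants in `C` to values in `K`. -/
structure Model {φ : Format} (Ω : Ops φ) (C K : Type) where
  cst : C → K
  op : (o : Ω.Op) → (Fin (Ω.arity o) → K) → K
  nat : ℕ → K
  toReal : K → ℝ

/-- Exact real arithmetic. -/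
def realModel {φ : Format} (Ω : Ops φ) : Model Ω ℝ ℝ where
  cst := id
  op := Ω.real
  nat := fun k => (k : ℝ)
  toReal := id

/-- Floating-point arithmetic. -/
noncomputable def floatModel {φ : Format} (Ω : Ops φ) (rnd : ℝ → Float φ) :
    Model Ω (FConst φ) (Float φ) where
  cst := FConst.flt
  op := Ω.flt
  nat := fun k => rnd (k : ℝ)
  toReal := Float.toReal

/-- The meaning of function symbols. -/
abbrev FunInterp (K : Type) := FName → (n : ℕ) → (Fin n → K) → K

open Classical in
/-- The index of the first condition that holds; the last index if there is none. -/
noncomputable def firstTrue : {m : ℕ} → (Fin m → Prop) → Fin (m + 1)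
  | 0, _ => 0
  | _ + 1, b => if b 0 then 0 else (firstTrue fun j => b j.succ).succ

section Eval

variable {φ : Format} {Ω : Ops φ} {C K : Type}

def AExp.eval (M : Model Ω C K) (J : FunInterp K) (σ : Var → K) : AExp Ω C → K
  | .const c => M.cst c
  | .var x => σ x
  | .op o args => M.op o (fun i => (args i).eval M J σ)
  | .call f n args => J f n (fun i => (args i).eval M J σ)

def BExp.holds (M : Model Ω C K) (J : FunInterp K) (σ : Var → K) : BExp Ω C → Prop
  | .tt => True
  | .ff => False
  | .and a b => a.holds M J σ ∧ b.holds M J σ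
  | .or a b => a.holds M J σ ∨ b.holds M J σ
  | .not a => ¬ a.holds M J σ
  | .sign c a => c.holds (M.toReal (a.eval M J σ)) 0

/-- The values `acc_0, acc_1, …` of the accumulator: `acc_{k+1}` is `step k acc_k`, where the first
value of the control variable is `i₀`. -/
def loopVal {α : Type} (step : ℕ → α → α) (i₀ : ℕ) (acc₀ : α) : ℕ → α
  | 0 => acc₀
  | k + 1 => step (i₀ + k) (loopVal step i₀ acc₀ k)

noncomputable def Stm.eval (M : Model Ω C K) (J : FunInterp K) : Stm Ω C → (Var → K) → K
  | .arith a, σ => a.eval M J σ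
  | .letIn x a s, σ => s.eval M J (Function.update σ x (a.eval M J σ))
  | .cond _ B S, σ => (S (firstTrue fun j => (B j).holds M J σ)).eval M J σ
  | .forLoop i₀ iN acc₀ i acc s, σ =>
      loopVal (fun k v => s.eval M J (bindLoop σ i acc (M.nat k) v)) i₀ (M.cst acc₀) (iN + 1 - i₀)

/-- The functions defined by a program. -/
noncomputable def interp (M : Model Ω C K) : Program Ω C → FunInterp K
  | [], _, _, _ => M.nat 0
  | d :: P, f, n, a =>
      if h : d.name = f ∧ d.arity = n then
        d.body.eval M (interp M P) (assign d.params (fun i => a (Fin.cast h.2 i)) fun _ => M.nat 0)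
      else interp M P f n a

end Eval

/-! ## Conditional error bounds and the denotational semantics -/

/-- Error expressions: the placeholder `χ_e(x)` for the error of `x`, the error bound function of
an operation applied to real values and errors, and `e + |r - r'|`. -/
inductive EExp {φ : Format} (Ω : Ops φ) : Type
  | num (c : ℝ)
  | err (x : Var)
  | bound (o : Ω.Op) (r : Fin (Ω.arity o) → AExp Ω ℝ) (e : Fin (Ω.arity o) → EExp Ω)
  | addDiff (e : EExp Ω) (r r' : AExp Ω ℝ)

/-- A conditional error bound `⟨η, η̃⟩ ↠ (r, ṽ, e)_t`; `unstable` is the flag `t = u`. In `η` and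
`r`, the variable `x` stands for `χ_r(x̃)`. -/
structure CEB {φ : Format} (Ω : Ops φ) where
  condR : BExp Ω ℝ
  condF : BExp Ω (FConst φ)
  valR : AExp Ω ℝ
  valF : AExp Ω (FConst φ)
  err : EExp Ω
  unstable : Bool

section Semantics

variable {φ : Format} {Ω : Ops φ}

/-- Substitution of `χ_r(x)` and `χ_e(x)`. -/
def EExp.subst (θr : Var → AExp Ω ℝ) (θe : Var → EExp Ω) : EExp Ω → EExp Ω
  | .num c => .num c
  | .err x => θe x
  | .bound o r e => .bound o (fun i => (r i).subst θr) (fun i => (e i).subst θr θe)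
  | .addDiff e r r' => .addDiff (e.subst θr θe) (r.subst θr) (r'.subst θr)

/-- The value of an error expression, given the values `σ` of the `χ_r(x)` and `ε` of the
`χ_e(x)`. -/
noncomputable def EExp.eval (J : FunInterp ℝ) (σ ε : Var → ℝ) : EExp Ω → ℝ
  | .num c => c
  | .err x => ε x
  | .bound o r e => Ω.bound o (fun i => (r i).eval (realModel Ω) J σ) (fun i => (e i).eval J σ ε)
  | .addDiff e r r' =>
      e.eval J σ ε + |r.eval (realModel Ω) J σ - r'.eval (realModel Ω) J σ|

/-- The conditional error bound of a constant. -/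
noncomputable def CEB.const (c : FConst φ) : CEB Ω :=
  ⟨.tt, .tt, .const c.real, .const c, .num |c.real - c.flt.toReal|, false⟩

/-- The conditional error bound of a parameter. -/
def CEB.var (x : Var) : CEB Ω := ⟨.tt, .tt, .var x, .var x, .err x, false⟩

/-- The join of the stability flags: unstable if some flag is unstable. -/
def joinFlags {n : ℕ} (cs : Fin n → CEB Ω) : Bool := decide (∃ i, (cs i).unstable = true)

/-- The conditional error bound of an operation, from those of its operands. -/
def CEB.op (o : Ω.Op) (cs : Fin (Ω.arity o) → CEB Ω) : CEB Ω where
  condR := BExp.conj (List.ofFn fun i => (cs i).condR)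
  condF := BExp.conj (List.ofFn fun i => (cs i).condF)
  valR := .op o fun i => (cs i).valR
  valF := .op o fun i => (cs i).valF
  err := .bound o (fun i => (cs i).valR) (fun i => (cs i).err)
  unstable := joinFlags cs

/-- Application of a function to arguments: `c` belongs to the body of the function, `cs` to the
actual arguments, and `θ` maps the formal parameters to `cs` and any other variable to itself. -/
def CEB.apply {n : ℕ} (c : CEB Ω) (θ : Var → CEB Ω) (cs : Fin n → CEB Ω) : CEB Ω where
  condR := .and (c.condR.subst fun x => (θ x).valR) (BExp.conj (List.ofFn fun i => (cs i).condR))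
  condF := .and (c.condF.subst fun x => (θ x).valF) (BExp.conj (List.ofFn fun i => (cs i).condF))
  valR := c.valR.subst fun x => (θ x).valR
  valF := c.valF.subst fun x => (θ x).valF
  err := c.err.subst (fun x => (θ x).valR) (fun x => (θ x).err)
  unstable := c.unstable || joinFlags cs

/-- The condition propagation operator (without its satisfiability proviso). -/
def CEB.propagate (b : BExp Ω ℝ) (b' : BExp Ω (FConst φ)) (c : CEB Ω) : CEB Ω where
  condR := .and c.condR b
  condF := .and c.condF b'
  valR := c.valR
  valF := c.valF
  err := c.err
  unstable := c.unstable

/-- The unstable combination: the real flow follows `ci`, the floating-point flow follows `cj`. -/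
def CEB.mix (ci cj : CEB Ω) : CEB Ω where
  condR := ci.condR
  condF := cj.condF
  valR := ci.valR
  valF := cj.valF
  err := .addDiff cj.err ci.valR cj.valR
  unstable := true

/-- What the function symbols mean in the conditions: their values in real arithmetic and in
floating-point arithmetic; `rnd` is the rounding. -/
structure Ctx {φ : Format} (Ω : Ops φ) where
  rnd : ℝ → Float φ
  real : FunInterp ℝ
  flt : FunInterp (Float φ)

/-- The conjunction of the two conditions is satisfiable. -/
def CEB.Sat (Γ : Ctx Ω) (c : CEB Ω) : Prop :=
  (∃ σ, c.condR.holds (realModel Ω) Γ.real σ) ∧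
    ∃ σ', c.condF.holds (floatModel Ω Γ.rnd) Γ.flt σ'

/-- Interpretations: to a function call `f(x_1, …, x_n)` a set of conditional error bounds. -/
abbrev Interpretation {φ : Format} (Ω : Ops φ) :=
  FName → (n : ℕ) → (Fin n → Var) → Set (CEB Ω)

/-- The semantics of arithmetic expressions. -/
def AExp.sem (Γ : Ctx Ω) (I : Interpretation Ω) : AExp Ω (FConst φ) → Set (CEB Ω)
  | .const c => {CEB.const c}
  | .var x => {CEB.var x}
  | .op o args =>
      {c | ∃ cs : Fin (Ω.arity o) → CEB Ω,
        (∀ i, cs i ∈ (args i).sem Γ I) ∧ c = CEB.op o cs ∧ c.Sat Γ}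
  | .call f n args =>
      {c | ∃ xs : Fin n → Var, ∃ c₀ ∈ I f n xs, ∃ cs : Fin n → CEB Ω,
        (∀ i, cs i ∈ (args i).sem Γ I) ∧ c = c₀.apply (assign xs cs CEB.var) cs ∧ c.Sat Γ}

/-- The semantics of program expressions.  A let-in expression is the application of `λ x. S`,
and a loop the iterated application of `λ (i, acc). S`. -/
def Stm.sem (Γ : Ctx Ω) (I : Interpretation Ω) : Stm Ω (FConst φ) → Set (CEB Ω)
  | .arith a => a.sem Γ I
  | .letIn x a s =>
      {c | ∃ c₀ ∈ s.sem Γ I, ∃ c₁ ∈ a.sem Γ I,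
        c = c₀.apply (Function.update CEB.var x c₁) ![c₁] ∧ c.Sat Γ}
  | .cond _ B S =>
      {c | ∃ i, ∃ c₀ ∈ (S i).sem Γ I,
        c = c₀.propagate (branchCond B i).toReal (branchCond B i) ∧ c.Sat Γ} ∪
      {c | ∃ i j, i ≠ j ∧ ∃ ci ∈ (S i).sem Γ I, ∃ cj ∈ (S j).sem Γ I,
        ci.unstable = false ∧ cj.unstable = false ∧
        c = (ci.mix cj).propagate (branchCond B i).toReal (branchCond B j) ∧ c.Sat Γ}
  | .forLoop i₀ iN acc₀ i acc s =>
      loopVal (fun k A => {c | ∃ c₀ ∈ s.sem Γ I, ∃ c₁ ∈ A,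
          c = c₀.apply (bindLoop CEB.var i acc (CEB.const (roundConst Γ.rnd k)) c₁)
            ![CEB.const (roundConst Γ.rnd k), c₁] ∧ c.Sat Γ})
        i₀ {CEB.const acc₀} (iN + 1 - i₀)

theorem AExp.sem_mono (Γ : Ctx Ω) {I I' : Interpretation Ω} (h : I ≤ I')
    (a : AExp Ω (FConst φ)) : a.sem Γ I ⊆ a.sem Γ I' := by
  induction a with
  | const c => exact subset_rfl
  | var x => exact subset_rfl
  | op o args ih =>
    rintro c ⟨cs, hcs, hc⟩
    exact ⟨cs, fun i => ih i (hcs i), hc⟩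
  | call f n args ih =>
    rintro c ⟨xs, c₀, h₀, cs, hcs, hc⟩
    exact ⟨xs, c₀, h f n xs h₀, cs, fun i => ih i (hcs i), hc⟩

theorem Stm.sem_mono (Γ : Ctx Ω) {I I' : Interpretation Ω} (h : I ≤ I')
    (s : Stm Ω (FConst φ)) : s.sem Γ I ⊆ s.sem Γ I' := by
  induction s with
  | arith a => exact a.sem_mono Γ h
  | letIn x a s ih =>
    rintro c ⟨c₀, h₀, c₁, h₁, hc⟩
    exact ⟨c₀, ih h₀, c₁, a.sem_mono Γ h h₁, hc⟩
  | cond m B S ih =>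
    rintro c (⟨i, c₀, h₀, hc⟩ | ⟨i, j, hij, ci, hi, cj, hj, hc⟩)
    · exact Or.inl ⟨i, c₀, ih i h₀, hc⟩
    · exact Or.inr ⟨i, j, hij, ci, ih i hi, cj, ih j hj, hc⟩
  | forLoop i₀ iN acc₀ i acc s ih =>
    simp only [Stm.sem]
    induction (iN + 1 - i₀) with
    | zero => exact subset_rfl
    | succ k ihk =>
      rintro c ⟨c₀, h₀, c₁, h₁, hc⟩
      exact ⟨c₀, ih h₀, c₁, ihk h₁, hc⟩

/-- The immediate consequence operator: `f(x_1, …, x_n)` is mapped to the semantics of `S` if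
`f(x_1, …, x_n) = S` is a declaration of the program. -/
def immediate (Γ : Ctx Ω) (P : Program Ω (FConst φ)) :
    Interpretation Ω →o Interpretation Ω where
  toFun I := fun f n xs =>
    {c | ∃ d ∈ P, d.name = f ∧ ∃ h : d.arity = n,
      (∀ i, xs (Fin.cast h i) = d.params i) ∧ c ∈ d.body.sem Γ I}
  monotone' := by
    rintro I I' h f n xs c ⟨d, hd, hf, hn, hx, hc⟩
    exact ⟨d, hd, hf, hn, hx, d.body.sem_mono Γ h hc⟩

/-- The conditions of the semantics of a floating-point program are evaluated with the functions
of its real counterpart and with its own functions. -/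
noncomputable def ctxOf (rnd : ℝ → Float φ) (P : Program Ω (FConst φ)) : Ctx Ω where
  rnd := rnd
  real := interp (realModel Ω) (toReal P)
  flt := interp (floatModel Ω rnd) P

/-- The semantics of a floating-point program: the least fixed point of the immediate consequence
operator. -/
noncomputable def progSem (rnd : ℝ → Float φ) (P : Program Ω (FConst φ)) : Interpretation Ω :=
  (immediate (ctxOf rnd P) P).lfp

/-- The values of the error expressions of the stable conditional error bounds of the function `d`
of the floating-point program `P`, for the real arguments `a` and the errors `ea` of the
arguments. -/
def stableErrors (rnd : ℝ → Float φ) (P : Program Ω (FConst φ)) (d : Decl Ω (FConst φ))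
    (a ea : Fin d.arity → ℝ) : Set ℝ :=
  {e | ∃ c ∈ progSem rnd P d.name d.arity d.params, c.unstable = false ∧
    e = c.err.eval (ctxOf rnd P).real (assign d.params a fun _ => 0) (assign d.params ea fun _ => 0)}

end Semantics

/-! ## Instrumented floating-point programs -/

/-- Error variables: `ε_var(A)` is named by the floating-point arithmetic expression `A`. -/
abbrev ErrVar {φ : Format} (Ω : Ops φ) := AExp Ω (FConst φ)

/-- The right-hand side of a comparison: `0`, an error variable, or the opposite of one. -/
inductive Thr (E : Type)
  | zero
  | pos (ε : E)
  | neg (ε : E)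

mutual

/-- Floating-point program expressions with the warning `omega`.  In `call f n args eargs`, the
actual error argument for the error parameter `ε` of `f` is the error variable `eargs ε`.
`cond m B S` has the guards `B 0, …, B (m - 1)` and the `else` branch `S m`. -/
inductive TExp {φ : Format} (Ω : Ops φ) : Type
  | const (c : FConst φ)
  | var (x : Var)
  | op (o : Ω.Op) (args : Fin (Ω.arity o) → TExp Ω)
  | call (f : FName) (n : ℕ) (args : Fin n → TExp Ω) (eargs : ErrVar Ω → ErrVar Ω)
  | letIn (x : Var) (a : TExp Ω) (s : TExp Ω)
  | cond (m : ℕ) (B : Fin m → TBExp Ω) (S : Fin (m + 1) → TExp Ω)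
  | forLoop (i₀ iN : ℕ) (acc₀ : FConst φ) (i acc : Var) (s : TExp Ω)
  | omega

/-- Guards of instrumented programs; `isOmega a` is the test `a = ω`. -/
inductive TBExp {φ : Format} (Ω : Ops φ) : Type
  | tt
  | ff
  | and (a b : TBExp Ω)
  | or (a b : TBExp Ω)
  | not (a : TBExp Ω)
  | cmp (c : Cmp) (a : TExp Ω) (t : Thr (ErrVar Ω))
  | isOmega (a : TExp Ω)

end

/-- A declaration `f^τ(x_1, …, x_n, ε_1, …, ε_k) = S`. -/
structure TDecl {φ : Format} (Ω : Ops φ) where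
  name : FName
  arity : ℕ
  params : Fin arity → Var
  errParams : Set (ErrVar Ω)
  body : TExp Ω

/-- An instrumented program: its declarations, from the last one to the first one. -/
abbrev TProgram {φ : Format} (Ω : Ops φ) := List (TDecl Ω)

section Instrumented

variable {φ : Format} {Ω : Ops φ}

/-- The meaning of instrumented functions; the result `none` is the warning `ω`. -/
abbrev TInterp {φ : Format} (Ω : Ops φ) :=
  FName → (n : ℕ) → (Fin n → Float φ) → (ErrVar Ω → Float φ) → Option (Float φ)

/-- All the values, if none of them is the warning. -/
def allSome {α : Type} {n : ℕ} (v : Fin n → Option α) : Option (Fin n → α) :=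
  if h : ∀ i, (v i).isSome = true then some fun i => (v i).get (h i) else none

/-- The index of the first guard that is true (the last index if there is none), or the warning if
a guard evaluated before is the warning. -/
def firstTrueO : {m : ℕ} → (Fin m → Option Bool) → Option (Fin (m + 1))
  | 0, _ => some 0
  | _ + 1, b => (b 0).bind fun t =>
      if t then some 0 else (firstTrueO fun j => b j.succ).map Fin.succ

/-- The real value of the right-hand side of a comparison. -/
noncomputable def Thr.val (ε : ErrVar Ω → Float φ) : Thr (ErrVar Ω) → ℝ
  | .zero => 0
  | .pos A => (ε A).toReal
  | .neg A => -(ε A).toReal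

mutual

/-- Evaluation of instrumented program expressions.  The warning is an exceptional value: it is
propagated by every construct, except for the test `a = ω`. -/
noncomputable def TExp.eval (rnd : ℝ → Float φ) (J : TInterp Ω) (ε : ErrVar Ω → Float φ) :
    TExp Ω → (Var → Float φ) → Option (Float φ)
  | .const c, _ => some c.flt
  | .var x, σ => some (σ x)
  | .op o args, σ => (allSome fun i => (args i).eval rnd J ε σ).map (Ω.flt o)
  | .call f n args eargs, σ =>
      (allSome fun i => (args i).eval rnd J ε σ).bind fun v => J f n v (fun A => ε (eargs A))
  | .letIn x a s, σ =>
      (a.eval rnd J ε σ).bind fun v => s.eval rnd J ε (Function.update σ x v)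
  | .cond _ B S, σ =>
      (firstTrueO fun j => (B j).eval rnd J ε σ).bind fun j => (S j).eval rnd J ε σ
  | .forLoop i₀ iN acc₀ i acc s, σ =>
      loopVal (fun k w => w.bind fun v => s.eval rnd J ε (bindLoop σ i acc (rnd k) v))
        i₀ (some acc₀.flt) (iN + 1 - i₀)
  | .omega, _ => none

/-- Evaluation of the guards of instrumented programs. -/
noncomputable def TBExp.eval (rnd : ℝ → Float φ) (J : TInterp Ω) (ε : ErrVar Ω → Float φ) :
    TBExp Ω → (Var → Float φ) → Option Bool
  | .tt, _ => some true
  | .ff, _ => some false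
  | .and a b, σ => (a.eval rnd J ε σ).bind fun s => (b.eval rnd J ε σ).map fun t => s && t
  | .or a b, σ => (a.eval rnd J ε σ).bind fun s => (b.eval rnd J ε σ).map fun t => s || t
  | .not a, σ => (a.eval rnd J ε σ).map fun s => !s
  | .cmp c a t, σ => (a.eval rnd J ε σ).map fun v =>
      @decide (c.holds v.toReal (t.val ε)) (Classical.propDecidable _)
  | .isOmega a, σ => some (a.eval rnd J ε σ).isNone

end

open Classical in
/-- The functions defined by an instrumented program.  The body of a declaration can only access
the values of its own error parameters. -/
noncomputable def runT (rnd : ℝ → Float φ) : TProgram Ω → TInterp Ω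
  | [], _, _, _, _ => none
  | d :: P, f, n, a, ε =>
      if h : d.name = f ∧ d.arity = n then
        d.body.eval rnd (runT rnd P) (fun A => if A ∈ d.errParams then ε A else Float.zero φ)
          (assign d.params (fun i => a (Fin.cast h.2 i)) fun _ => Float.zero φ)
      else runT rnd P f n a ε

/-- The formal parameters of the function `f` of arity `n` in an instrumented program. -/
def formalParams : TProgram Ω → FName → (n : ℕ) → Fin n → Var
  | [], _, _ => fun _ => 0
  | d :: P, f, n =>
      if h : d.name = f ∧ d.arity = n then fun i => d.params (Fin.cast h.2.symm i)
      else formalParams P f n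

/-- The error parameters of the function `f` of arity `n` in an instrumented program. -/
def formalErrs : TProgram Ω → FName → ℕ → Set (ErrVar Ω)
  | [], _, _ => ∅
  | d :: P, f, n => if d.name = f ∧ d.arity = n then d.errParams else formalErrs P f n

/-! ## The program transformation

`T` is the part of the transformed program that has already been built. -/

def TExp.ite (b : TBExp Ω) (s₁ s₂ : TExp Ω) : TExp Ω := .cond 1 (fun _ => b) ![s₁, s₂]

/-- Finite disjunctions. -/
def TBExp.disj : List (TBExp Ω) → TBExp Ω
  | [] => .ff
  | b :: l => .or b (TBExp.disj l)

/-- Finite conjunctions. -/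
def TBExp.conj : List (TBExp Ω) → TBExp Ω
  | [] => .tt
  | b :: l => .and b (TBExp.conj l)

/-- In a call of the function with formal parameters `xs` and actual parameters `args`, the error
parameter `ε_var(A)` is instantiated with `ε_var(A[xs ← args])`. -/
noncomputable def errArg {n : ℕ} (xs : Fin n → Var) (args : Fin n → AExp Ω (FConst φ)) :
    ErrVar Ω → ErrVar Ω :=
  fun A => A.subst (assign xs args AExp.var)

/-- `τ` on arithmetic expressions. -/
noncomputable def AExp.tau (T : TProgram Ω) : AExp Ω (FConst φ) → TExp Ω
  | .const c => .const c
  | .var x => .var x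
  | .op o args =>
      TExp.ite (TBExp.disj (List.ofFn fun i => .isOmega ((args i).tau T)))
        .omega (.op o fun i => (args i).tau T)
  | .call f n args =>
      TExp.ite (TBExp.disj (List.ofFn fun i => .isOmega ((args i).tau T)))
        .omega (.call f n (fun i => (args i).tau T) (errArg (formalParams T f n) args))

/-- The error variables introduced by `τ` in an arithmetic expression. -/
def AExp.tauVars (T : TProgram Ω) : AExp Ω (FConst φ) → Set (ErrVar Ω)
  | .const _ => ∅
  | .var _ => ∅
  | .op _ args => ⋃ i, (args i).tauVars T
  | .call f n args =>
      (⋃ i, (args i).tauVars T) ∪ errArg (formalParams T f n) args '' formalErrs T f n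

/-- A guard with unchanged tests. -/
noncomputable def BExp.lift (T : TProgram Ω) : BExp Ω (FConst φ) → TBExp Ω
  | .tt => .tt
  | .ff => .ff
  | .and a b => .and (a.lift T) (b.lift T)
  | .or a b => .or (a.lift T) (b.lift T)
  | .not a => .not (a.lift T)
  | .sign c a => .cmp c (a.tau T) .zero

/-- The test `β⁺(A ⋄ 0)`, where `a` is the transformed expression `A`. -/
def betaPosTest (A : AExp Ω (FConst φ)) (a : TExp Ω) : Cmp → TBExp Ω
  | .le => .cmp .le a (.neg A)
  | .ge => .cmp .ge a (.pos A)
  | .lt => .cmp .lt a (.neg A)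
  | .gt => .cmp .gt a (.pos A)

/-- The test `β⁻(A ⋄ 0)`, where `a` is the transformed expression `A`. -/
def betaNegTest (A : AExp Ω (FConst φ)) (a : TExp Ω) : Cmp → TBExp Ω
  | .le => .cmp .gt a (.pos A)
  | .ge => .cmp .lt a (.neg A)
  | .lt => .cmp .ge a (.pos A)
  | .gt => .cmp .le a (.neg A)

/-- The Boolean abstractions: `β⁺` for `pol = true` and `β⁻` for `pol = false`. -/
noncomputable def BExp.beta (T : TProgram Ω) : Bool → BExp Ω (FConst φ) → TBExp Ω
  | true, .tt => .tt
  | false, .tt => .ff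
  | true, .ff => .ff
  | false, .ff => .tt
  | true, .and a b => .and (a.beta T true) (b.beta T true)
  | false, .and a b => .or (a.beta T false) (b.beta T false)
  | true, .or a b => .or (a.beta T true) (b.beta T true)
  | false, .or a b => .and (a.beta T false) (b.beta T false)
  | true, .not a => a.beta T false
  | false, .not a => a.beta T true
  | true, .sign c a => betaPosTest a (a.tau T) c
  | false, .sign c a => betaNegTest a (a.tau T) c

/-- `B = β⁺(B)` and `¬ B = β⁻(B)` as logical equivalences: the round-off error does not affect the
evaluation of the guard. -/
def BExp.Unaffected (rnd : ℝ → Float φ) (T : TProgram Ω) (B : BExp Ω (FConst φ)) : Prop :=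
  ∀ (J : TInterp Ω) (ε : ErrVar Ω → Float φ) (σ : Var → Float φ),
    (B.lift T).eval rnd J ε σ = (B.beta T true).eval rnd J ε σ ∧
    (TBExp.not (B.lift T)).eval rnd J ε σ = (B.beta T false).eval rnd J ε σ

/-- The restricted guard of branch `i`: `β⁺(B_i) ∧ ⋀_{j < i} β⁻(B_j)`, and `⋀_j β⁻(B_j)` for the
`else` branch. -/
noncomputable def betaBranch (T : TProgram Ω) {m : ℕ} (B : Fin (m + 1) → BExp Ω (FConst φ))
    (i : Fin (m + 2)) : TBExp Ω :=
  .and (if h : (i : ℕ) < m + 1 then (B ⟨i, h⟩).beta T true else .tt)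
    (TBExp.conj
      (((List.finRange (m + 1)).filter fun j : Fin (m + 1) => j.val < i.val).map fun j => (B j).beta T false))

/-- The test that an arithmetic expression occurring in the guards is the warning. -/
noncomputable def guardsOmega (T : TProgram Ω) {m : ℕ} (B : Fin (m + 1) → BExp Ω (FConst φ)) :
    TBExp Ω :=
  TBExp.disj (((List.ofFn B).flatMap BExp.atoms).map fun A => .isOmega (A.tau T))

open Classical in
/-- `τ` on program expressions. -/
noncomputable def Stm.tau (rnd : ℝ → Float φ) (T : TProgram Ω) : Stm Ω (FConst φ) → TExp Ω
  | .arith a => a.tau T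
  | .letIn x a s =>
      TExp.ite (.isOmega (a.tau T)) .omega (.letIn x (a.tau T) (s.tau rnd T))
  | .cond m B S =>
      if ∀ j, (B j).Unaffected rnd T then
        .cond (m + 1) (fun j => (B j).lift T) (fun j => (S j).tau rnd T)
      else
        .cond (m + 3)
          (Fin.cons (α := fun _ => TBExp Ω) (guardsOmega T B) (betaBranch T B))
          (Fin.cons (α := fun _ => TExp Ω) .omega
            (Fin.snoc (α := fun _ => TExp Ω) (fun j => (S j).tau rnd T) .omega))
  | .forLoop i₀ iN acc₀ i acc s => .forLoop i₀ iN acc₀ i acc (s.tau rnd T)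

/-- The error variables introduced by `τ` in a program expression. -/
def Stm.tauVars (rnd : ℝ → Float φ) (T : TProgram Ω) : Stm Ω (FConst φ) → Set (ErrVar Ω)
  | .arith a => a.tauVars T
  | .letIn _ a s => a.tauVars T ∪ s.tauVars rnd T
  | .cond _ B S =>
      (⋃ j, (S j).tauVars rnd T) ∪
      {ε | ∃ j, ∃ A ∈ (B j).atoms, ε ∈ A.tauVars T} ∪
      {ε | (¬ ∀ j, (B j).Unaffected rnd T) ∧ ∃ j, ε ∈ (B j).atoms}
  | .forLoop _ _ _ _ _ s => s.tauVars rnd T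

/-- The transformation of a floating-point program. -/
noncomputable def tauProgram (rnd : ℝ → Float φ) : Program Ω (FConst φ) → TProgram Ω
  | [] => []
  | d :: P =>
      ⟨d.name, d.arity, d.params, d.body.tauVars rnd (tauProgram rnd P),
        d.body.tau rnd (tauProgram rnd P)⟩ :: tauProgram rnd P

/-- The program transformation `τ̄`, on real programs. -/
noncomputable def transform (rnd : ℝ → Float φ) (P : Program Ω ℝ) : TProgram Ω :=
  tauProgram rnd (toFloat rnd P)

/-! ## Error variables bound the errors that they stand for

The value of `ε_var(A)` must be at least `|A - R(A)|`.  As `A` may contain local variables and may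
belong to the body of a function that is called, this is required for all the values that the
local variables (the formal parameters) take in real and in floating-point arithmetic. -/

/-- For each function, real arguments, float arguments and values of the error variables: the error
variables of the body are valid. -/
abbrev ErrCond {φ : Format} (Ω : Ops φ) :=
  FName → (n : ℕ) → (Fin n → ℝ) → (Fin n → Float φ) → (ErrVar Ω → Float φ) → Prop

def AExp.errValid (Γ : Ctx Ω) (T : TProgram Ω) (V : ErrCond Ω) (ε : ErrVar Ω → Float φ)
    (σ : Var → ℝ) (σ' : Var → Float φ) : AExp Ω (FConst φ) → Prop
  | .const _ => True
  | .var _ => True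
  | .op _ args => ∀ i, (args i).errValid Γ T V ε σ σ'
  | .call f n args =>
      (∀ i, (args i).errValid Γ T V ε σ σ') ∧
      V f n (fun i => (args i).toReal.eval (realModel Ω) Γ.real σ)
        (fun i => (args i).eval (floatModel Ω Γ.rnd) Γ.flt σ')
        (fun A => ε (errArg (formalParams T f n) args A))

def Stm.errValid (Γ : Ctx Ω) (T : TProgram Ω) (V : ErrCond Ω) (ε : ErrVar Ω → Float φ) :
    Stm Ω (FConst φ) → (Var → ℝ) → (Var → Float φ) → Prop
  | .arith a, σ, σ' => a.errValid Γ T V ε σ σ'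
  | .letIn x a s, σ, σ' =>
      a.errValid Γ T V ε σ σ' ∧
      s.errValid Γ T V ε (Function.update σ x (a.toReal.eval (realModel Ω) Γ.real σ))
        (Function.update σ' x (a.eval (floatModel Ω Γ.rnd) Γ.flt σ'))
  | .cond _ B S, σ, σ' =>
      (∀ j, ∀ A ∈ (B j).atoms, A.errValid Γ T V ε σ σ') ∧
      ((¬ ∀ j, (B j).Unaffected Γ.rnd T) → ∀ j, ∀ A ∈ (B j).atoms,
        |(A.eval (floatModel Ω Γ.rnd) Γ.flt σ').toReal -
          A.toReal.eval (realModel Ω) Γ.real σ| ≤ (ε A).toReal) ∧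
      ∀ j, (S j).errValid Γ T V ε σ σ'
  | .forLoop i₀ iN acc₀ i acc s, σ, σ' =>
      ∀ k < iN + 1 - i₀,
        s.errValid Γ T V ε
          (bindLoop σ i acc ((i₀ + k : ℕ) : ℝ)
            (loopVal (fun k v => s.toReal.eval (realModel Ω) Γ.real (bindLoop σ i acc (k : ℝ) v))
              i₀ acc₀.real k))
          (bindLoop σ' i acc (Γ.rnd ((i₀ + k : ℕ) : ℝ))
            (loopVal (fun k v => s.eval (floatModel Ω Γ.rnd) Γ.flt
              (bindLoop σ' i acc (Γ.rnd (k : ℝ)) v)) i₀ acc₀.flt k))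

/-- The values `ε` of the error variables are valid for the given call of a function of the
floating-point program. -/
def errValid (rnd : ℝ → Float φ) : Program Ω (FConst φ) → ErrCond Ω
  | [], _, _, _, _, _ => True
  | d :: P, f, n, a, v, ε =>
      if h : d.name = f ∧ d.arity = n then
        d.body.errValid (ctxOf rnd P) (tauProgram rnd P) (errValid rnd P) ε
          (assign d.params (fun i => a (Fin.cast h.2 i)) fun _ => 0)
          (assign d.params (fun i => v (Fin.cast h.2 i)) fun _ => Float.zero φ)
      else errValid rnd P f n a v ε

/-- `|r - w| ≤ b`; it does not hold if `w` is the warning. -/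
def diffLe (r : ℝ) (w : Option (Float φ)) (b : ℝ) : Prop :=
  ∃ v, w = some v ∧ |r - v.toReal| ≤ b

end Instrumented

end FPTrans

/-!
The direction from right to left is immediate, since `|f - ω| ≤ e` is false by convention.  For the
converse, suppose that the instrumented function returns a float `w`.

* Without warnings, the instrumented program computes what the floating-point program computes, and
  at every conditional the real and the floating-point flow take the same branch
  (`Stm.exists_branch_of_eval_tau`).  If the conditional is abstracted, this holds because `β⁺` and
  `β⁻` are sound for valid error variables (`BExp.holds_of_eval_beta`).  If it is not, all its
  guards are equivalent to their abstractions for *all* values of the error variables.  As floats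
  are unbounded, there are values that bound the actual errors, and for these the abstractions are
  sound (`BExp.Unaffected.holds_iff`).
* Along this common path, the semantics contains a stable conditional error bound whose conditions
  hold in the current state, whose symbolic results evaluate to the actual ones, and whose symbolic
  error evaluates to a bound of the actual error.  This is `CEB.Tracks`.  It is preserved by
  operations, applications (calls, let-in, loops) and condition propagation, and the current state
  witnesses satisfiability, so the tuple is never dropped.  The induction over expressions is
  `Stm.tracks_of_eval_tau`, the one over declarations is `funCorrect_runT`.
* There is no recursion, so every function has finitely many conditional error bounds
  (`progSem_finite`).  With the tuple above, the stable errors form a finite nonempty set: their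
  maximum exists and bounds the actual error.
-/

namespace FPTrans

/-! ### Evaluation, substitution and programs -/

section Congruence

variable {φ : Format} {Ω : Ops φ} {C D K : Type}

theorem assign_apply {α : Type} {n : ℕ} {xs : Fin n → Var} (hxs : Function.Injective xs)
    (vs : Fin n → α) (dflt : Var → α) (i : Fin n) : assign xs vs dflt (xs i) = vs i := by
  have h : ∃ j, xs j = xs i := ⟨i, rfl⟩
  rw [assign, dif_pos h, hxs h.choose_spec]

theorem AExp.fv_map (g : C → D) (a : AExp Ω C) : (a.map g).fv = a.fv := by
  induction a <;> simp_all [AExp.map, AExp.fv]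

theorem BExp.fv_map (g : C → D) (b : BExp Ω C) : (b.map g).fv = b.fv := by
  induction b <;> simp_all [BExp.map, BExp.fv, AExp.fv_map]

theorem Stm.fv_map (g : C → D) (s : Stm Ω C) : (s.map g).fv = s.fv := by
  induction s <;> simp_all [Stm.map, Stm.fv, AExp.fv_map, BExp.fv_map]

theorem AExp.calls_map (g : C → D) (a : AExp Ω C) : (a.map g).calls = a.calls := by
  induction a <;> simp_all [AExp.map, AExp.calls]

theorem BExp.calls_map (g : C → D) (b : BExp Ω C) : (b.map g).calls = b.calls := by
  induction b <;> simp_all [BExp.map, BExp.calls, AExp.calls_map]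

theorem Stm.calls_map (g : C → D) (s : Stm Ω C) : (s.map g).calls = s.calls := by
  induction s <;> simp_all [Stm.map, Stm.calls, AExp.calls_map, BExp.calls_map]

theorem AExp.map_map {E : Type} (g : C → D) (h : D → E) (a : AExp Ω C) :
    (a.map g).map h = a.map (h ∘ g) := by
  induction a <;> simp_all [AExp.map]

theorem BExp.map_map {E : Type} (g : C → D) (h : D → E) (b : BExp Ω C) :
    (b.map g).map h = b.map (h ∘ g) := by
  induction b <;> simp_all [BExp.map, AExp.map_map]

theorem Stm.map_map {E : Type} (g : C → D) (h : D → E) (s : Stm Ω C) :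
    (s.map g).map h = s.map (h ∘ g) := by
  induction s <;> simp_all [Stm.map, AExp.map_map, BExp.map_map]

theorem AExp.map_id (a : AExp Ω C) : a.map id = a := by
  induction a <;> simp_all [AExp.map]

theorem BExp.map_id (b : BExp Ω C) : b.map id = b := by
  induction b <;> simp_all [BExp.map, AExp.map_id]

theorem Stm.map_id (s : Stm Ω C) : s.map id = s := by
  induction s <;> simp_all [Stm.map, AExp.map_id, BExp.map_id]

theorem toReal_toFloat (rnd : ℝ → Float φ) (P : Program Ω ℝ) : toReal (toFloat rnd P) = P := by
  have h : FConst.real ∘ roundConst rnd = id := rfl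
  simp only [toReal, toFloat, List.map_map]
  refine (List.map_congr_left fun d _ => ?_).trans (List.map_id P)
  simp [Decl.map, Stm.map_map, h, Stm.map_id]

theorem declared_map (g : C → D) (P : Program Ω C) :
    declared (P.map (Decl.map g)) = declared P := by
  ext q
  simp [declared, Decl.map]

theorem WellFormed.map (g : C → D) {P : Program Ω C} (h : WellFormed P) :
    WellFormed (P.map (Decl.map g)) := by
  induction P with
  | nil => trivial
  | cons d P ih =>
    obtain ⟨h₁, h₂, h₃, h₄⟩ := h
    refine ⟨by rw [declared_map]; exact h₁, ?_, ?_, ih h₄⟩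
    · simpa only [Decl.map, Stm.fv_map] using h₂
    · rw [declared_map]
      simpa only [Decl.map, Stm.calls_map] using h₃

theorem WellFormed.eq_of_mem {P : Program Ω C} (h : WellFormed P) {d d' : Decl Ω C}
    (hd : d ∈ P) (hd' : d' ∈ P) (hn : d.name = d'.name) (ha : d.arity = d'.arity) : d = d' := by
  induction P with
  | nil => simp at hd
  | cons e P ih =>
    obtain ⟨h₁, -, -, h₄⟩ := h
    rcases List.mem_cons.1 hd with h | h <;> rcases List.mem_cons.1 hd' with h' | h'
    · exact h.trans h'.symm
    · exact absurd ⟨d', h', by rw [← h, hn, ha]⟩ h₁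
    · exact absurd ⟨d, h, by rw [← h', hn, ha]⟩ h₁
    · exact ih h₄ h h'

theorem AExp.eval_congr (M : Model Ω C K) (J : FunInterp K) {σ τ : Var → K} (a : AExp Ω C)
    (h : Set.EqOn σ τ a.fv) : a.eval M J σ = a.eval M J τ := by
  induction a with
  | const c => rfl
  | var x => exact h (Set.mem_singleton x)
  | op o args ih =>
    simp only [AExp.eval]
    congr 1
    funext i
    exact ih i (h.mono (Set.subset_iUnion (fun i => (args i).fv) i))
  | call f n args ih =>
    simp only [AExp.eval]
    congr 1
    funext i
    exact ih i (h.mono (Set.subset_iUnion (fun i => (args i).fv) i))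

theorem BExp.holds_congr (M : Model Ω C K) (J : FunInterp K) {σ τ : Var → K} (b : BExp Ω C)
    (h : Set.EqOn σ τ b.fv) : b.holds M J σ ↔ b.holds M J τ := by
  induction b with
  | tt => rfl
  | ff => rfl
  | and a b iha ihb =>
    exact and_congr (iha (h.mono Set.subset_union_left)) (ihb (h.mono Set.subset_union_right))
  | or a b iha ihb =>
    exact or_congr (iha (h.mono Set.subset_union_left)) (ihb (h.mono Set.subset_union_right))
  | not a ih => exact not_congr (ih h)
  | sign c a => simp only [BExp.holds, a.eval_congr M J h]

theorem Stm.eval_congr (M : Model Ω C K) (J : FunInterp K) {σ τ : Var → K} (s : Stm Ω C)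
    (h : Set.EqOn σ τ s.fv) : s.eval M J σ = s.eval M J τ := by
  induction s generalizing σ τ with
  | arith a => exact a.eval_congr M J h
  | letIn x a s ih =>
    simp only [Stm.eval]
    rw [a.eval_congr M J (h.mono Set.subset_union_left)]
    refine ih fun y hy => ?_
    by_cases hyx : y = x
    · simp [hyx]
    · simpa [hyx] using h (Or.inr ⟨hy, hyx⟩)
  | cond m B S ih =>
    have hB : (fun j => (B j).holds M J σ) = fun j => (B j).holds M J τ := by
      funext j
      exact propext ((B j).holds_congr M J (h.mono
        ((Set.subset_iUnion (fun j => (B j).fv) j).trans Set.subset_union_left)))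
    simp only [Stm.eval, hB]
    exact ih _ (h.mono ((Set.subset_iUnion (fun j => (S j).fv) _).trans Set.subset_union_right))
  | forLoop i₀ iN acc₀ i acc s ih =>
    simp only [Stm.eval]
    congr 1
    funext k v
    refine ih fun y hy => ?_
    simp only [bindLoop, Function.update_apply]
    split_ifs with hya hyi
    · rfl
    · rfl
    · exact h ⟨hy, by simp [hya, hyi]⟩

theorem AExp.eval_congr_interp (M : Model Ω C K) {J J' : FunInterp K} (σ : Var → K)
    (a : AExp Ω C) (h : ∀ f n, (f, n) ∈ a.calls → J f n = J' f n) :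
    a.eval M J σ = a.eval M J' σ := by
  induction a with
  | const c => rfl
  | var x => rfl
  | op o args ih =>
    simp only [AExp.eval]
    congr 1
    funext i
    exact ih i fun f n hf => h f n (Set.mem_iUnion_of_mem i hf)
  | call f n args ih =>
    simp only [AExp.eval]
    rw [h f n (Or.inl rfl)]
    congr 1
    funext i
    exact ih i fun f n hf => h f n (Or.inr (Set.mem_iUnion_of_mem i hf))

theorem BExp.holds_congr_interp (M : Model Ω C K) {J J' : FunInterp K} (σ : Var → K)
    (b : BExp Ω C) (h : ∀ f n, (f, n) ∈ b.calls → J f n = J' f n) :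
    b.holds M J σ ↔ b.holds M J' σ := by
  induction b with
  | tt => rfl
  | ff => rfl
  | and a b iha ihb =>
    exact and_congr (iha fun f n hf => h f n (Or.inl hf)) (ihb fun f n hf => h f n (Or.inr hf))
  | or a b iha ihb =>
    exact or_congr (iha fun f n hf => h f n (Or.inl hf)) (ihb fun f n hf => h f n (Or.inr hf))
  | not a ih => exact not_congr (ih h)
  | sign c a => simp only [BExp.holds, a.eval_congr_interp M σ h]

theorem Stm.eval_congr_interp (M : Model Ω C K) {J J' : FunInterp K} (s : Stm Ω C)
    (h : ∀ f n, (f, n) ∈ s.calls → J f n = J' f n) : s.eval M J = s.eval M J' := by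
  induction s with
  | arith a => funext σ; exact a.eval_congr_interp M σ h
  | letIn x a s ih =>
    funext σ
    simp only [Stm.eval]
    rw [a.eval_congr_interp M σ fun f n hf => h f n (Or.inl hf),
      ih fun f n hf => h f n (Or.inr hf)]
  | cond m B S ih =>
    funext σ
    have hB : (fun j => (B j).holds M J σ) = fun j => (B j).holds M J' σ := by
      funext j
      exact propext ((B j).holds_congr_interp M σ fun f n hf =>
        h f n (Or.inl (Set.mem_iUnion_of_mem j hf)))
    simp only [Stm.eval, hB]
    rw [ih _ fun f n hf => h f n (Or.inr (Set.mem_iUnion_of_mem _ hf))]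
  | forLoop i₀ iN acc₀ i acc s ih =>
    funext σ
    simp only [Stm.eval]
    rw [ih h]

theorem declared_mono {P Q : Program Ω C} (h : Q ⊆ P) : declared Q ⊆ declared P := by
  rintro q ⟨d, hd, hq⟩
  exact ⟨d, h hd, hq⟩

theorem WellFormed.of_suffix {P Q : Program Ω C} (hP : WellFormed P) (h : Q <:+ P) :
    WellFormed Q := by
  obtain ⟨L, rfl⟩ := h
  induction L with
  | nil => exact hP
  | cons e L ih => exact ih hP.2.2.2

/-- Later declarations do not change the functions declared before. -/
theorem interp_suffix (M : Model Ω C K) {P Q : Program Ω C} (hP : WellFormed P) (h : Q <:+ P)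
    {f : FName} {n : ℕ} (hf : (f, n) ∈ declared Q) : interp M P f n = interp M Q f n := by
  obtain ⟨L, rfl⟩ := h
  induction L with
  | nil => rfl
  | cons e L ih =>
    obtain ⟨h₁, -, -, h₄⟩ := hP
    have hne : ¬ (e.name = f ∧ e.arity = n) := by
      rintro ⟨rfl, rfl⟩
      exact h₁ (declared_mono (List.subset_append_right L Q) hf)
    rw [← ih h₄]
    funext a
    simp only [List.cons_append, interp, dif_neg hne]

/-- The value of a call is that of the body, whatever values `δ` the variables other than the
parameters have. -/
theorem interp_decl (M : Model Ω C K) {P Q : Program Ω C} {d : Decl Ω C} (hP : WellFormed P)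
    (h : d :: Q <:+ P) (a : Fin d.arity → K) (δ : Var → K) :
    interp M P d.name d.arity a = d.body.eval M (interp M P) (assign d.params a δ) := by
  have hδ : Set.EqOn (assign d.params a δ) (assign d.params a fun _ => M.nat 0) d.body.fv := by
    refine Set.EqOn.mono (hP.of_suffix h).2.1 ?_
    rintro _ ⟨i, rfl⟩
    rw [assign_apply d.params_inj, assign_apply d.params_inj]
  rw [interp_suffix M hP h ⟨d, List.mem_cons_self, rfl⟩, d.body.eval_congr M _ hδ,
    d.body.eval_congr_interp M (J := interp M P) (J' := interp M Q) fun f n hf => interp_suffix M hP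
      ((List.suffix_cons d Q).trans h) ((hP.of_suffix h).2.2.1 hf)]
  simp [interp]

theorem AExp.eval_subst (M : Model Ω C K) (J : FunInterp K) (σ : Var → K) (θ : Var → AExp Ω C)
    (a : AExp Ω C) : (a.subst θ).eval M J σ = a.eval M J fun x => (θ x).eval M J σ := by
  induction a <;> simp_all [AExp.subst, AExp.eval]

theorem BExp.holds_subst (M : Model Ω C K) (J : FunInterp K) (σ : Var → K) (θ : Var → AExp Ω C)
    (b : BExp Ω C) : (b.subst θ).holds M J σ ↔ b.holds M J fun x => (θ x).eval M J σ := by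
  induction b <;> simp_all [BExp.subst, BExp.holds, AExp.eval_subst]

theorem EExp.eval_subst (J : FunInterp ℝ) (σ ε : Var → ℝ) (θr : Var → AExp Ω ℝ)
    (θe : Var → EExp Ω) (e : EExp Ω) :
    (e.subst θr θe).eval J σ ε =
      e.eval J (fun x => (θr x).eval (realModel Ω) J σ) fun x => (θe x).eval J σ ε := by
  induction e <;> simp_all [EExp.subst, EExp.eval, AExp.eval_subst]

theorem BExp.holds_conj (M : Model Ω C K) (J : FunInterp K) (σ : Var → K) (l : List (BExp Ω C)) :
    (BExp.conj l).holds M J σ ↔ ∀ b ∈ l, b.holds M J σ := by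
  induction l <;> simp_all [BExp.conj, BExp.holds]

theorem holds_branchCond (M : Model Ω C K) (J : FunInterp K) (σ : Var → K) {m : ℕ}
    (B : Fin (m + 1) → BExp Ω C) (i : Fin (m + 2)) :
    (branchCond B i).holds M J σ ↔ (∀ h : (i : ℕ) < m + 1, (B ⟨i, h⟩).holds M J σ) ∧
      ∀ j : Fin (m + 1), (j : ℕ) < i → ¬ (B j).holds M J σ := by
  rw [branchCond, BExp.holds, BExp.holds_conj]
  refine and_congr ?_ ?_
  · by_cases h : (i : ℕ) < m + 1 <;> simp [h, BExp.holds]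
  · simp [BExp.holds]

theorem branchCond_map (g : C → D) {m : ℕ} (B : Fin (m + 1) → BExp Ω C) (i : Fin (m + 2)) :
    (branchCond B i).map g = branchCond (fun j => (B j).map g) i := by
  have hconj : ∀ l : List (BExp Ω C), (BExp.conj l).map g = BExp.conj (l.map (BExp.map g)) := by
    intro l
    induction l <;> simp_all [BExp.conj, BExp.map]
  rw [branchCond, branchCond, BExp.map, hconj]
  congr 1
  · split <;> rfl
  · simp [Function.comp_def, BExp.map]

theorem firstTrue_eq_iff {m : ℕ} (b : Fin m → Prop) (i : Fin (m + 1)) :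
    firstTrue b = i ↔ (∀ h : (i : ℕ) < m, b ⟨i, h⟩) ∧ ∀ j : Fin m, (j : ℕ) < i → ¬ b j := by
  induction m with
  | zero => simp [firstTrue, Fin.eq_zero i]
  | succ m ih =>
    by_cases h0 : b 0
    · simp only [firstTrue, if_pos h0]
      constructor
      · rintro rfl
        exact ⟨fun _ => h0, fun j hj => absurd hj (by simp)⟩
      · rintro ⟨-, h⟩
        by_contra hi
        exact h 0 (by simpa [Fin.pos_iff_ne_zero] using Ne.symm hi) h0
    · simp only [firstTrue, if_neg h0]
      refine Fin.cases ?_ (fun i => ?_) i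
      · simpa [Fin.succ_ne_zero] using h0
      · rw [Fin.succ_inj, ih, Fin.forall_fin_succ]
        simp [h0]

end Congruence

/-! ### Finiteness of the semantics -/

section Finiteness

variable {φ : Format} {Ω : Ops φ} {Γ : Ctx Ω} {I : Interpretation Ω}

theorem AExp.sem_finite (a : AExp Ω (FConst φ))
    (hI : ∀ f n, (f, n) ∈ a.calls → {p : (Fin n → Var) × CEB Ω | p.2 ∈ I f n p.1}.Finite) :
    (a.sem Γ I).Finite := by
  induction a with
  | const c => exact Set.finite_singleton _
  | var x => exact Set.finite_singleton _
  | op o args ih =>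
    have h := Set.Finite.pi' fun i => ih i fun f n hf => hI f n (Set.mem_iUnion_of_mem i hf)
    refine (h.image (CEB.op o)).subset ?_
    rintro c ⟨cs, hcs, rfl, -⟩
    exact ⟨cs, hcs, rfl⟩
  | call f n args ih =>
    have h := Set.Finite.pi' fun i => ih i fun f n hf => hI f n (Or.inr (Set.mem_iUnion_of_mem i hf))
    refine (((hI f n (Or.inl rfl)).prod h).image
      fun q => q.1.2.apply (assign q.1.1 q.2 CEB.var) q.2).subset ?_
    rintro c ⟨xs, c₀, h₀, cs, hcs, rfl, -⟩
    exact ⟨((xs, c₀), cs), ⟨h₀, hcs⟩, rfl⟩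

theorem Stm.sem_finite (s : Stm Ω (FConst φ))
    (hI : ∀ f n, (f, n) ∈ s.calls → {p : (Fin n → Var) × CEB Ω | p.2 ∈ I f n p.1}.Finite) :
    (s.sem Γ I).Finite := by
  induction s with
  | arith a => exact a.sem_finite hI
  | letIn x a s ih =>
    have h₁ := a.sem_finite (Γ := Γ) fun f n hf => hI f n (Or.inl hf)
    refine (((ih fun f n hf => hI f n (Or.inr hf)).prod h₁).image
      fun q => q.1.apply (Function.update CEB.var x q.2) ![q.2]).subset ?_
    rintro c ⟨c₀, h₀, c₁, h₁, rfl, -⟩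
    exact ⟨(c₀, c₁), ⟨h₀, h₁⟩, rfl⟩
  | cond m B S ih =>
    have h := fun i => ih i fun f n hf => hI f n (Or.inr (Set.mem_iUnion_of_mem i hf))
    refine Set.Finite.union ?_ ?_
    · refine (Set.finite_iUnion fun i => (h i).image
        (CEB.propagate (branchCond B i).toReal (branchCond B i))).subset ?_
      rintro c ⟨i, c₀, h₀, rfl, -⟩
      exact Set.mem_iUnion_of_mem i ⟨c₀, h₀, rfl⟩
    · refine (Set.finite_iUnion fun i => Set.finite_iUnion fun j => ((h i).prod (h j)).image
        fun q => (q.1.mix q.2).propagate (branchCond B i).toReal (branchCond B j)).subset ?_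
      rintro c ⟨i, j, -, ci, hi, cj, hj, -, -, rfl, -⟩
      exact Set.mem_iUnion_of_mem i (Set.mem_iUnion_of_mem j ⟨(ci, cj), ⟨hi, hj⟩, rfl⟩)
  | forLoop i₀ iN acc₀ i acc s ih =>
    simp only [Stm.sem]
    induction iN + 1 - i₀ with
    | zero => exact Set.finite_singleton _
    | succ k ihk =>
      refine (((ih hI).prod ihk).image fun q =>
        q.1.apply (bindLoop CEB.var i acc (CEB.const (roundConst Γ.rnd ((i₀ + k : ℕ) : ℝ))) q.2)
          ![CEB.const (roundConst Γ.rnd ((i₀ + k : ℕ) : ℝ)), q.2]).subset ?_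
      rintro c ⟨c₀, h₀, c₁, h₁, rfl, -⟩
      exact ⟨(c₀, c₁), ⟨h₀, h₁⟩, rfl⟩

/-- The semantics of a program is a fixed point; its leastness is not needed, as the bodies only
call functions declared before. -/
theorem progSem_eq (rnd : ℝ → Float φ) (P : Program Ω (FConst φ)) :
    immediate (ctxOf rnd P) P (progSem rnd P) = progSem rnd P :=
  (immediate (ctxOf rnd P) P).map_lfp

theorem body_sem_subset_progSem (rnd : ℝ → Float φ) {P : Program Ω (FConst φ)}
    {d : Decl Ω (FConst φ)} (hd : d ∈ P) :
    d.body.sem (ctxOf rnd P) (progSem rnd P) ⊆ progSem rnd P d.name d.arity d.params := by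
  intro c hc
  rw [← progSem_eq]
  exact ⟨d, hd, rfl, rfl, fun _ => rfl, hc⟩

/-- There is no recursion, so every function has only finitely many conditional error bounds: this
is why the maximum error exists. -/
theorem progSem_finite (rnd : ℝ → Float φ) {P Q : Program Ω (FConst φ)} (hP : WellFormed P)
    (hQ : Q <:+ P) {f : FName} {n : ℕ} (hf : (f, n) ∈ declared Q) :
    {p : (Fin n → Var) × CEB Ω | p.2 ∈ progSem rnd P f n p.1}.Finite := by
  induction Q generalizing f n with
  | nil => simp [declared] at hf
  | cons e Q ih =>
    have hQ' := (List.suffix_cons e Q).trans hQ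
    by_cases he : (f, n) ∈ declared Q
    · exact ih hQ' he
    · obtain ⟨d, hd, h⟩ := hf
      obtain ⟨rfl, rfl⟩ := Prod.mk.inj h
      rcases List.mem_cons.1 hd with rfl | hd
      · have hfin := d.body.sem_finite (Γ := ctxOf rnd P) (I := progSem rnd P) fun f n hf =>
          ih hQ' ((hP.of_suffix hQ).2.2.1 hf)
        refine (hfin.image fun c => (d.params, c)).subset ?_
        rintro ⟨xs, c⟩ hc
        change c ∈ progSem rnd P d.name d.arity xs at hc
        rw [← progSem_eq] at hc
        obtain ⟨d', hd', hn, ha, hx, hc⟩ := hc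
        obtain rfl := hP.eq_of_mem hd' (hQ.subset List.mem_cons_self) hn ha
        exact ⟨c, hc, Prod.ext (funext fun i => (hx i).symm) rfl⟩
      · exact absurd ⟨d, hd, rfl⟩ he

end Finiteness

/-! ### The conditional error bound of an execution -/

section Tracking

variable {φ : Format} {Ω : Ops φ} {Γ : Ctx Ω}

/-- The conditional error bound `c` is stable and describes the computation in which the variables
in `X` have the values `σ` in real and `σ'` in floating-point arithmetic, and the results are `r`
and `v`: in every state that agrees with `σ` and `σ'` on `X`, both conditions hold, the symbolic
results have the values `r` and `v`, and the symbolic error bounds `|v - r|` as soon as `χ` bounds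
the errors of the variables in `X`. -/
structure CEB.Tracks (Γ : Ctx Ω) (c : CEB Ω) (X : Set Var) (σ : Var → ℝ) (σ' : Var → Float φ)
    (r : ℝ) (v : Float φ) : Prop where
  stable : c.unstable = false
  condR : ∀ ρ, Set.EqOn ρ σ X → c.condR.holds (realModel Ω) Γ.real ρ
  condF : ∀ ρ', Set.EqOn ρ' σ' X → c.condF.holds (floatModel Ω Γ.rnd) Γ.flt ρ'
  valR : ∀ ρ, Set.EqOn ρ σ X → c.valR.eval (realModel Ω) Γ.real ρ = r
  valF : ∀ ρ', Set.EqOn ρ' σ' X → c.valF.eval (floatModel Ω Γ.rnd) Γ.flt ρ' = v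
  err : ∀ ρ χ, Set.EqOn ρ σ X → (∀ x ∈ X, |(σ' x).toReal - σ x| ≤ χ x) →
    |v.toReal - r| ≤ c.err.eval Γ.real ρ χ

namespace CEB.Tracks

variable {c : CEB Ω} {X Y : Set Var} {σ τ : Var → ℝ} {σ' τ' : Var → Float φ} {r : ℝ} {v : Float φ}

/-- The state that is tracked witnesses the satisfiability of both conditions. -/
theorem sat (h : c.Tracks Γ X σ σ' r v) : c.Sat Γ :=
  ⟨⟨σ, h.condR σ fun _ _ => rfl⟩, ⟨σ', h.condF σ' fun _ _ => rfl⟩⟩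

theorem mono (h : c.Tracks Γ X σ σ' r v) (hXY : X ⊆ Y) : c.Tracks Γ Y σ σ' r v where
  stable := h.stable
  condR ρ hρ := h.condR ρ (hρ.mono hXY)
  condF ρ hρ := h.condF ρ (hρ.mono hXY)
  valR ρ hρ := h.valR ρ (hρ.mono hXY)
  valF ρ hρ := h.valF ρ (hρ.mono hXY)
  err ρ χ hρ hχ := h.err ρ χ (hρ.mono hXY) fun x hx => hχ x (hXY hx)

theorem congr (h : c.Tracks Γ X σ σ' r v) (hσ : Set.EqOn τ σ X) (hσ' : Set.EqOn τ' σ' X) :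
    c.Tracks Γ X τ τ' r v where
  stable := h.stable
  condR ρ hρ := h.condR ρ (hρ.trans hσ)
  condF ρ hρ := h.condF ρ (hρ.trans hσ')
  valR ρ hρ := h.valR ρ (hρ.trans hσ)
  valF ρ hρ := h.valF ρ (hρ.trans hσ')
  err ρ χ hρ hχ := h.err ρ χ (hρ.trans hσ) fun x hx => by
    rw [← hσ hx, ← hσ' hx]
    exact hχ x hx

theorem const (fc : FConst φ) (X : Set Var) (σ : Var → ℝ) (σ' : Var → Float φ) :
    (CEB.const fc : CEB Ω).Tracks Γ X σ σ' fc.real fc.flt where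
  stable := rfl
  condR _ _ := trivial
  condF _ _ := trivial
  valR _ _ := rfl
  valF _ _ := rfl
  err _ _ _ _ := (abs_sub_comm _ _).le

theorem var {x : Var} (hx : x ∈ X) (σ : Var → ℝ) (σ' : Var → Float φ) :
    (CEB.var x : CEB Ω).Tracks Γ X σ σ' (σ x) (σ' x) where
  stable := rfl
  condR _ _ := trivial
  condF _ _ := trivial
  valR _ hρ := hρ hx
  valF _ hρ := hρ hx
  err _ _ _ hχ := hχ x hx

theorem op {o : Ω.Op} {cs : Fin (Ω.arity o) → CEB Ω} {rs : Fin (Ω.arity o) → ℝ}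
    {vs : Fin (Ω.arity o) → Float φ} (h : ∀ i, (cs i).Tracks Γ X σ σ' (rs i) (vs i)) :
    (CEB.op o cs).Tracks Γ X σ σ' (Ω.real o rs) (Ω.flt o vs) where
  stable := by simp [CEB.op, joinFlags, fun i => (h i).stable]
  condR ρ hρ := by
    simp only [CEB.op, BExp.holds_conj, List.mem_ofFn]
    rintro _ ⟨i, rfl⟩
    exact (h i).condR ρ hρ
  condF ρ hρ := by
    simp only [CEB.op, BExp.holds_conj, List.mem_ofFn]
    rintro _ ⟨i, rfl⟩
    exact (h i).condF ρ hρ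
  valR ρ hρ := congrArg (Ω.real o) (funext fun i => (h i).valR ρ hρ)
  valF ρ hρ := congrArg (Ω.flt o) (funext fun i => (h i).valF ρ hρ)
  err ρ χ hρ hχ := by
    simp only [CEB.op, EExp.eval, fun i => (h i).valR ρ hρ]
    exact Ω.bound_sound o vs rs _ fun i => (h i).err ρ χ hρ hχ

/-- Application: `τ` and `τ'` are the values of the variables of the body. -/
theorem apply (hc : c.Tracks Γ Y τ τ' r v) {θ : Var → CEB Ω}
    (hθ : ∀ y ∈ Y, (θ y).Tracks Γ X σ σ' (τ y) (τ' y))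
    {n : ℕ} {cs : Fin n → CEB Ω} {rs : Fin n → ℝ} {vs : Fin n → Float φ}
    (hcs : ∀ i, (cs i).Tracks Γ X σ σ' (rs i) (vs i)) :
    (c.apply θ cs).Tracks Γ X σ σ' r v where
  stable := by simp [CEB.apply, joinFlags, hc.stable, fun i => (hcs i).stable]
  condR ρ hρ := by
    simp only [CEB.apply, BExp.holds, BExp.holds_subst, BExp.holds_conj, List.mem_ofFn]
    refine ⟨hc.condR _ fun y hy => (hθ y hy).valR ρ hρ, ?_⟩
    rintro _ ⟨i, rfl⟩
    exact (hcs i).condR ρ hρ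
  condF ρ hρ := by
    simp only [CEB.apply, BExp.holds, BExp.holds_subst, BExp.holds_conj, List.mem_ofFn]
    refine ⟨hc.condF _ fun y hy => (hθ y hy).valF ρ hρ, ?_⟩
    rintro _ ⟨i, rfl⟩
    exact (hcs i).condF ρ hρ
  valR ρ hρ := by
    simp only [CEB.apply, AExp.eval_subst]
    exact hc.valR _ fun y hy => (hθ y hy).valR ρ hρ
  valF ρ hρ := by
    simp only [CEB.apply, AExp.eval_subst]
    exact hc.valF _ fun y hy => (hθ y hy).valF ρ hρ
  err ρ χ hρ hχ := by
    simp only [CEB.apply, EExp.eval_subst]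
    exact hc.err _ _ (fun y hy => (hθ y hy).valR ρ hρ) fun y hy => (hθ y hy).err ρ χ hρ hχ

theorem propagate (hc : c.Tracks Γ X σ σ' r v) {b : BExp Ω ℝ} {b' : BExp Ω (FConst φ)}
    (hb : ∀ ρ, Set.EqOn ρ σ X → b.holds (realModel Ω) Γ.real ρ)
    (hb' : ∀ ρ', Set.EqOn ρ' σ' X → b'.holds (floatModel Ω Γ.rnd) Γ.flt ρ') :
    (c.propagate b b').Tracks Γ X σ σ' r v where
  stable := hc.stable
  condR ρ hρ := ⟨hc.condR ρ hρ, hb ρ hρ⟩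
  condF ρ hρ := ⟨hc.condF ρ hρ, hb' ρ hρ⟩
  valR := hc.valR
  valF := hc.valF
  err := hc.err

end CEB.Tracks

end Tracking

/-! ### Warnings and abstractions of guards -/

section TEval

variable {φ : Format} {Ω : Ops φ} {rnd : ℝ → Float φ} {J : TInterp Ω} {ε : ErrVar Ω → Float φ}
  {σ : Var → Float φ}

theorem allSome_eq_some {α : Type} {n : ℕ} {v : Fin n → Option α} {w : Fin n → α} :
    allSome v = some w ↔ ∀ i, v i = some (w i) := by
  rw [allSome]
  split_ifs with h
  · simp only [Option.some.injEq, funext_iff]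
    refine forall_congr' fun i => ?_
    rw [← Option.some_inj, Option.some_get]
  · refine ⟨fun h => by simp at h, fun hw => absurd (fun i => by simp [hw i]) h⟩

theorem firstTrueO_eq_some {m : ℕ} {b : Fin m → Option Bool} {i : Fin (m + 1)}
    (h : firstTrueO b = some i) : (∀ h : (i : ℕ) < m, b ⟨i, h⟩ = some true) ∧
      ∀ j : Fin m, (j : ℕ) < i → b j = some false := by
  induction m with
  | zero => exact ⟨fun h => absurd h (by omega), fun j => j.elim0⟩
  | succ m ih =>
    obtain ⟨t, h0, ht⟩ := Option.bind_eq_some_iff.1 h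
    cases t with
    | true =>
      obtain rfl : 0 = i := by simpa using ht
      exact ⟨fun _ => h0, fun j hj => absurd hj (by simp)⟩
    | false =>
      obtain ⟨k, hk, rfl⟩ : ∃ k, firstTrueO (fun j => b j.succ) = some k ∧ k.succ = i := by
        simpa using ht
      obtain ⟨h₁, h₂⟩ := ih hk
      refine ⟨fun h => h₁ (by simpa using h), fun j => ?_⟩
      refine Fin.cases (fun _ => h0) (fun j hj => h₂ j (by simpa using hj)) j

theorem TExp.eval_ite (b : TBExp Ω) (s₁ s₂ : TExp Ω) :
    (TExp.ite b s₁ s₂).eval rnd J ε σ = (b.eval rnd J ε σ).bind fun t =>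
      if t then s₁.eval rnd J ε σ else s₂.eval rnd J ε σ := by
  simp only [TExp.ite, TExp.eval, firstTrueO]
  rcases b.eval rnd J ε σ with _ | _ | _ <;> simp

theorem TBExp.eval_disj_isOmega {ι : Type} (l : List ι) (g : ι → TExp Ω) :
    (TBExp.disj (l.map fun a => .isOmega (g a))).eval rnd J ε σ =
      some (l.any fun a => ((g a).eval rnd J ε σ).isNone) := by
  induction l with
  | nil => simp [TBExp.disj, TBExp.eval]
  | cons a l ih => simp [TBExp.disj, TBExp.eval, ih]

/-- The test for warnings among the arguments is redundant: the evaluation of an operation or a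
call propagates them. -/
theorem TExp.eval_ite_disj_isOmega {n : ℕ} (args : Fin n → TExp Ω) {s : TExp Ω}
    (hs : ∀ i, (args i).eval rnd J ε σ = none → s.eval rnd J ε σ = none) :
    (TExp.ite (TBExp.disj (List.ofFn fun i => .isOmega (args i))) .omega s).eval rnd J ε σ =
      s.eval rnd J ε σ := by
  have h : (List.ofFn fun i => TBExp.isOmega (args i)) =
      (List.finRange n).map fun i => TBExp.isOmega (args i) := by rw [List.ofFn_eq_map]
  rw [h, TExp.eval_ite, TBExp.eval_disj_isOmega]
  simp only [Option.bind_some]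
  split_ifs with hany
  · simp only [List.any_eq_true, List.mem_finRange, true_and, Option.isNone_iff_eq_none] at hany
    obtain ⟨i, hi⟩ := hany
    rw [hs i hi, TExp.eval]
  · rfl

theorem allSome_eq_none {α : Type} {n : ℕ} {v : Fin n → Option α} {i : Fin n} (h : v i = none) :
    allSome v = none := by
  rw [allSome, dif_neg]
  intro hv
  simpa [h] using hv i

theorem AExp.eval_tau_op (T : TProgram Ω) (o : Ω.Op) (args : Fin (Ω.arity o) → AExp Ω (FConst φ)) :
    ((AExp.op o args).tau T).eval rnd J ε σ =
      (allSome fun i => ((args i).tau T).eval rnd J ε σ).map (Ω.flt o) := by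
  rw [AExp.tau, TExp.eval_ite_disj_isOmega, TExp.eval]
  intro i hi
  rw [TExp.eval, allSome_eq_none hi, Option.map_none]

theorem AExp.eval_tau_call (T : TProgram Ω) (f : FName) (n : ℕ)
    (args : Fin n → AExp Ω (FConst φ)) :
    ((AExp.call f n args).tau T).eval rnd J ε σ =
      (allSome fun i => ((args i).tau T).eval rnd J ε σ).bind fun v =>
        J f n v fun A => ε (errArg (formalParams T f n) args A) := by
  rw [AExp.tau, TExp.eval_ite_disj_isOmega, TExp.eval]
  intro i hi
  rw [TExp.eval, allSome_eq_none hi, Option.bind_none]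

/-- If the functions called never return a warning, nor do arithmetic expressions. -/
theorem AExp.eval_tau_of_total (T : TProgram Ω) (K : FunInterp (Float φ))
    (a : AExp Ω (FConst φ)) :
    (a.tau T).eval rnd (fun f n v _ => some (K f n v)) ε σ =
      some (a.eval (floatModel Ω rnd) K σ) := by
  induction a with
  | const c => rw [AExp.tau, TExp.eval]; rfl
  | var x => rw [AExp.tau, TExp.eval]; rfl
  | op o args ih =>
    rw [AExp.eval_tau_op, allSome_eq_some.2 ih]
    rfl
  | call f n args ih =>
    rw [AExp.eval_tau_call, allSome_eq_some.2 ih]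
    rfl

/-- Every real number is bounded by a float, as the exponents are not bounded from above. -/
theorem exists_le_toReal (φ : Format) (r : ℝ) : ∃ x : Float φ, r ≤ x.toReal := by
  have hb : (1 : ℝ) < φ.base := by exact_mod_cast φ.two_le_base
  obtain ⟨n, hn⟩ := pow_unbounded_of_one_lt r hb
  have hb' : (1 : ℤ) < φ.base := by exact_mod_cast φ.two_le_base
  refine ⟨⟨1, max n (-φ.emin), ?_, le_max_right _ _⟩, ?_⟩
  · rw [abs_one]
    exact one_lt_pow₀ hb' (by have := φ.one_le_prec; omega)
  · simp only [Float.toReal, Int.cast_one, one_mul]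
    refine hn.le.trans ?_
    rw [← zpow_natCast]
    exact zpow_le_zpow_right₀ hb.le (le_max_left _ _)

/-- Lifted guards have the truth values of floating-point arithmetic. -/
theorem BExp.eval_lift {T : TProgram Ω} {K : FunInterp (Float φ)} {B : BExp Ω (FConst φ)}
    (hB : ∀ A ∈ B.atoms, ∀ w, (A.tau T).eval rnd J ε σ = some w →
      w = A.eval (floatModel Ω rnd) K σ)
    {t : Bool} (ht : (B.lift T).eval rnd J ε σ = some t) :
    t = true ↔ B.holds (floatModel Ω rnd) K σ := by
  induction B generalizing t with
  | tt =>
    rw [BExp.lift, TBExp.eval] at ht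
    simp_all [BExp.holds]
  | ff =>
    rw [BExp.lift, TBExp.eval] at ht
    simp_all [BExp.holds]
  | and a b iha ihb =>
    simp only [BExp.lift, TBExp.eval, Option.bind_eq_some_iff, Option.map_eq_some_iff] at ht
    obtain ⟨s, hs, s', hs', rfl⟩ := ht
    rw [BExp.holds, ← iha (fun A hA => hB A (List.mem_append_left _ hA)) hs,
      ← ihb (fun A hA => hB A (List.mem_append_right _ hA)) hs', Bool.and_eq_true]
  | or a b iha ihb =>
    simp only [BExp.lift, TBExp.eval, Option.bind_eq_some_iff, Option.map_eq_some_iff] at ht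
    obtain ⟨s, hs, s', hs', rfl⟩ := ht
    rw [BExp.holds, ← iha (fun A hA => hB A (List.mem_append_left _ hA)) hs,
      ← ihb (fun A hA => hB A (List.mem_append_right _ hA)) hs', Bool.or_eq_true]
  | not a ih =>
    simp only [BExp.lift, TBExp.eval, Option.map_eq_some_iff] at ht
    obtain ⟨s, hs, rfl⟩ := ht
    rw [BExp.holds, ← ih hB hs]
    cases s <;> simp
  | sign c a =>
    simp only [BExp.lift, TBExp.eval, Option.map_eq_some_iff] at ht
    obtain ⟨w, hw, rfl⟩ := ht
    obtain rfl := hB a (List.mem_singleton.2 rfl) w hw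
    exact @decide_eq_true_iff _ (Classical.propDecidable _)

theorem BExp.eval_lift_isSome {T : TProgram Ω} {B : BExp Ω (FConst φ)}
    (hB : ∀ A ∈ B.atoms, ((A.tau T).eval rnd J ε σ).isSome = true) :
    ∃ t, (B.lift T).eval rnd J ε σ = some t := by
  induction B with
  | tt => exact ⟨_, by rw [BExp.lift, TBExp.eval]⟩
  | ff => exact ⟨_, by rw [BExp.lift, TBExp.eval]⟩
  | and a b iha ihb =>
    obtain ⟨s, hs⟩ := iha fun A hA => hB A (List.mem_append_left _ hA)
    obtain ⟨t, ht⟩ := ihb fun A hA => hB A (List.mem_append_right _ hA)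
    exact ⟨_, by rw [BExp.lift, TBExp.eval, hs, ht]; rfl⟩
  | or a b iha ihb =>
    obtain ⟨s, hs⟩ := iha fun A hA => hB A (List.mem_append_left _ hA)
    obtain ⟨t, ht⟩ := ihb fun A hA => hB A (List.mem_append_right _ hA)
    exact ⟨_, by rw [BExp.lift, TBExp.eval, hs, ht]; rfl⟩
  | not a ih =>
    obtain ⟨s, hs⟩ := ih hB
    exact ⟨_, by rw [BExp.lift, TBExp.eval, hs]; rfl⟩
  | sign c a =>
    obtain ⟨w, hw⟩ := Option.isSome_iff_exists.1 (hB a (List.mem_singleton.2 rfl))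
    exact ⟨_, by rw [BExp.lift, TBExp.eval, hw]; rfl⟩

/-- The abstractions are sound: if `β⁺(B)` is true then `B` holds in floating-point and in real
arithmetic, and if `β⁻(B)` is true then `B` holds in neither. -/
theorem BExp.holds_of_eval_beta {T : TProgram Ω} {K : FunInterp (Float φ)} {L : FunInterp ℝ}
    {ρ : Var → ℝ} {B : BExp Ω (FConst φ)}
    (hB : ∀ A ∈ B.atoms, ∀ w, (A.tau T).eval rnd J ε σ = some w →
      w = A.eval (floatModel Ω rnd) K σ)
    (hε : ∀ A ∈ B.atoms, |(A.eval (floatModel Ω rnd) K σ).toReal -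
      A.toReal.eval (realModel Ω) L ρ| ≤ (ε A).toReal)
    {pol : Bool} (h : (B.beta T pol).eval rnd J ε σ = some true) :
    (B.holds (floatModel Ω rnd) K σ ↔ pol = true) ∧
      (B.toReal.holds (realModel Ω) L ρ ↔ pol = true) := by
  induction B generalizing pol with
  | tt => cases pol <;> simp_all [BExp.beta, TBExp.eval, BExp.holds, BExp.toReal, BExp.map]
  | ff => cases pol <;> simp_all [BExp.beta, TBExp.eval, BExp.holds, BExp.toReal, BExp.map]
  | and a b iha ihb =>
    have iha := fun pol => @iha (fun A hA => hB A (List.mem_append_left _ hA))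
      (fun A hA => hε A (List.mem_append_left _ hA)) pol
    have ihb := fun pol => @ihb (fun A hA => hB A (List.mem_append_right _ hA))
      (fun A hA => hε A (List.mem_append_right _ hA)) pol
    cases pol
    · simp only [BExp.beta, TBExp.eval, Option.bind_eq_some_iff, Option.map_eq_some_iff,
        Bool.or_eq_true] at h
      obtain ⟨s, hs, t, ht, rfl | rfl⟩ := h
      · exact ⟨iff_of_false (fun h => by simpa using (iha _ hs).1.1 h.1) (by simp),
          iff_of_false (fun h => by simpa using (iha _ hs).2.1 h.1) (by simp)⟩
      · exact ⟨iff_of_false (fun h => by simpa using (ihb _ ht).1.1 h.2) (by simp),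
          iff_of_false (fun h => by simpa using (ihb _ ht).2.1 h.2) (by simp)⟩
    · simp only [BExp.beta, TBExp.eval, Option.bind_eq_some_iff, Option.map_eq_some_iff,
        Bool.and_eq_true] at h
      obtain ⟨s, hs, t, ht, rfl, rfl⟩ := h
      exact ⟨(and_congr (iha _ hs).1 (ihb _ ht).1).trans and_self_iff,
        (and_congr (iha _ hs).2 (ihb _ ht).2).trans and_self_iff⟩
  | or a b iha ihb =>
    have iha := fun pol => @iha (fun A hA => hB A (List.mem_append_left _ hA))
      (fun A hA => hε A (List.mem_append_left _ hA)) pol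
    have ihb := fun pol => @ihb (fun A hA => hB A (List.mem_append_right _ hA))
      (fun A hA => hε A (List.mem_append_right _ hA)) pol
    cases pol
    · simp only [BExp.beta, TBExp.eval, Option.bind_eq_some_iff, Option.map_eq_some_iff,
        Bool.and_eq_true] at h
      obtain ⟨s, hs, t, ht, rfl, rfl⟩ := h
      exact ⟨(or_congr (iha _ hs).1 (ihb _ ht).1).trans or_self_iff,
        (or_congr (iha _ hs).2 (ihb _ ht).2).trans or_self_iff⟩
    · simp only [BExp.beta, TBExp.eval, Option.bind_eq_some_iff, Option.map_eq_some_iff,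
        Bool.or_eq_true] at h
      obtain ⟨s, hs, t, ht, rfl | rfl⟩ := h
      · exact ⟨iff_of_true (Or.inl ((iha _ hs).1.2 rfl)) rfl,
          iff_of_true (Or.inl ((iha _ hs).2.2 rfl)) rfl⟩
      · exact ⟨iff_of_true (Or.inr ((ihb _ ht).1.2 rfl)) rfl,
          iff_of_true (Or.inr ((ihb _ ht).2.2 rfl)) rfl⟩
  | not a ih =>
    cases pol
    · obtain ⟨h₁, h₂⟩ := ih hB hε (pol := true) h
      exact ⟨iff_of_false (not_not_intro (h₁.2 rfl)) (by simp),
        iff_of_false (not_not_intro (h₂.2 rfl)) (by simp)⟩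
    · obtain ⟨h₁, h₂⟩ := ih hB hε (pol := false) h
      exact ⟨iff_of_true (fun h => by simpa using h₁.1 h) rfl,
        iff_of_true (fun h => by simpa using h₂.1 h) rfl⟩
  | sign c a =>
    have hab := abs_le.1 (hε a (List.mem_singleton.2 rfl))
    have hB' := hB a (List.mem_singleton.2 rfl)
    cases pol <;> cases c <;>
    · simp only [BExp.beta, betaPosTest, betaNegTest, TBExp.eval, Option.map_eq_some_iff] at h
      obtain ⟨w, hw, h⟩ := h
      obtain rfl := hB' w hw
      replace h := @of_decide_eq_true _ (Classical.propDecidable _) h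
      simp only [Cmp.holds, Thr.val] at h
      simp only [BExp.holds, BExp.toReal, BExp.map, Cmp.holds, floatModel, realModel, id,
        AExp.toReal, Bool.false_eq_true, iff_false, iff_true, not_lt, not_le] at h hab ⊢
      constructor <;> linarith

/-- An unaffected guard has the same truth value in real and in floating-point arithmetic, whatever
the round-off errors are: it is equivalent to its abstractions for all values of the error
variables, in particular for values that bound these errors. -/
theorem BExp.Unaffected.holds_iff {T : TProgram Ω} {B : BExp Ω (FConst φ)}
    (h : B.Unaffected rnd T) (K : FunInterp (Float φ)) (L : FunInterp ℝ) (σ : Var → Float φ)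
    (ρ : Var → ℝ) :
    B.holds (floatModel Ω rnd) K σ ↔ B.toReal.holds (realModel Ω) L ρ := by
  -- Interpreting calls by total functions excludes warnings, so that both sides have truth values.
  choose ε hε using fun A : AExp Ω (FConst φ) => exists_le_toReal φ
    |(A.eval (floatModel Ω rnd) K σ).toReal - A.toReal.eval (realModel Ω) L ρ|
  obtain ⟨hpos, hneg⟩ := h (fun f n v _ => some (K f n v)) ε σ
  obtain ⟨t, ht⟩ := BExp.eval_lift_isSome (rnd := rnd) (J := fun f n v _ => some (K f n v))
    (ε := ε) (σ := σ) (T := T) (B := B) fun A _ => by rw [A.eval_tau_of_total]; rfl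
  have hB : ∀ A ∈ B.atoms, ∀ w,
      (A.tau T).eval rnd (fun f n v _ => some (K f n v)) ε σ = some w →
      w = A.eval (floatModel Ω rnd) K σ := fun A _ w hw => by
    rw [A.eval_tau_of_total] at hw
    exact (Option.some.inj hw).symm
  cases t with
  | true =>
    obtain ⟨h₁, h₂⟩ := BExp.holds_of_eval_beta hB (fun A _ => hε A) (hpos ▸ ht)
    exact h₁.trans h₂.symm
  | false =>
    rw [TBExp.eval, ht] at hneg
    obtain ⟨h₁, h₂⟩ := BExp.holds_of_eval_beta hB (fun A _ => hε A) hneg.symm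
    exact h₁.trans h₂.symm

end TEval

/-! ### Soundness of the transformation of expressions -/

section Soundness

variable {φ : Format} {Ω : Ops φ} {Γ : Ctx Ω} {I : Interpretation Ω} {T : TProgram Ω}
  {V : ErrCond Ω} {J : TInterp Ω} {ε : ErrVar Ω → Float φ}

/-- The instrumented function `J f n` is correct: whenever the error variables are valid (`V`) and
no warning is issued, the result is the one of the floating-point function, and the semantics `I`
has a stable conditional error bound that describes this call. -/
def FunCorrect (Γ : Ctx Ω) (I : Interpretation Ω) (V : ErrCond Ω) (J : TInterp Ω) (f : FName)
    (n : ℕ) : Prop :=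
  ∀ (a : Fin n → ℝ) (v : Fin n → Float φ) (ε : ErrVar Ω → Float φ) (w : Float φ),
    V f n a v ε → J f n v ε = some w → w = Γ.flt f n v ∧
      ∃ xs : Fin n → Var, Function.Injective xs ∧ ∃ c ∈ I f n xs,
        ∀ τ τ', (∀ i, τ (xs i) = a i) → (∀ i, τ' (xs i) = v i) →
          c.Tracks Γ (Set.range xs) τ τ' (Γ.real f n a) w

/-- If a transformed arithmetic expression returns no warning, it returns the floating-point value,
and the semantics contains a conditional error bound of this execution. -/
theorem AExp.tracks_of_eval_tau (a : AExp Ω (FConst φ))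
    (hJ : ∀ f n, (f, n) ∈ a.calls → FunCorrect Γ I V J f n) {σ : Var → ℝ} {σ' : Var → Float φ}
    (hε : a.errValid Γ T V ε σ σ') {w : Float φ} (hw : (a.tau T).eval Γ.rnd J ε σ' = some w) :
    w = a.eval (floatModel Ω Γ.rnd) Γ.flt σ' ∧ ∃ c ∈ a.sem Γ I,
      c.Tracks Γ a.fv σ σ' (a.toReal.eval (realModel Ω) Γ.real σ) w := by
  induction a generalizing w with
  | const c =>
    rw [AExp.tau, TExp.eval] at hw
    obtain rfl := Option.some.inj hw
    exact ⟨rfl, _, rfl, CEB.Tracks.const c _ σ σ'⟩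
  | var x =>
    rw [AExp.tau, TExp.eval] at hw
    obtain rfl := Option.some.inj hw
    exact ⟨rfl, _, rfl, CEB.Tracks.var (Set.mem_singleton x) σ σ'⟩
  | op o args ih =>
    rw [AExp.eval_tau_op, Option.map_eq_some_iff] at hw
    obtain ⟨vs, hvs, rfl⟩ := hw
    have h := fun i => ih i (fun f n hf => hJ f n (Set.mem_iUnion_of_mem i hf)) (hε i)
      (allSome_eq_some.1 hvs i)
    choose hv cs hcs htr using h
    have htr := CEB.Tracks.op fun i => (htr i).mono (Set.subset_iUnion (fun i => (args i).fv) i)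
    exact ⟨congrArg (Ω.flt o) (funext hv), _, ⟨cs, hcs, rfl, htr.sat⟩, htr⟩
  | call f n args ih =>
    rw [AExp.eval_tau_call, Option.bind_eq_some_iff] at hw
    obtain ⟨vs, hvs, hw⟩ := hw
    have h := fun i => ih i (fun f n hf => hJ f n (Or.inr (Set.mem_iUnion_of_mem i hf))) (hε.1 i)
      (allSome_eq_some.1 hvs i)
    choose hv cs hcs htr using h
    have htr := fun i => (htr i).mono (Set.subset_iUnion (fun i => (args i).fv) i)
    have hvs' : vs = fun i => (args i).eval (floatModel Ω Γ.rnd) Γ.flt σ' := funext hv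
    obtain ⟨rfl, xs, hxs, c₀, hc₀, htr₀⟩ := hJ f n (Or.inl rfl) _ vs _ w (hvs' ▸ hε.2) hw
    have htr₀ := htr₀ (assign xs _ fun _ => 0) (assign xs vs fun _ => Float.zero φ)
      (assign_apply hxs _ _) (assign_apply hxs _ _)
    have htr := htr₀.apply (X := ⋃ i, (args i).fv) (σ := σ) (σ' := σ')
      (θ := assign xs cs CEB.var) (by
        rintro _ ⟨i, rfl⟩
        simp only [assign_apply hxs]
        exact htr i) htr
    exact ⟨congrArg (Γ.flt f n) hvs', _, ⟨xs, c₀, hc₀, cs, hcs, rfl, htr.sat⟩, htr⟩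

/-- A conditional error bound of the branch taken by both flows gives one of the conditional. -/
theorem CEB.Tracks.cond {m : ℕ} {B : Fin (m + 1) → BExp Ω (FConst φ)}
    {S : Fin (m + 2) → Stm Ω (FConst φ)} {i : Fin (m + 2)} {σ : Var → ℝ} {σ' : Var → Float φ}
    (hF : firstTrue (fun j => (B j).holds (floatModel Ω Γ.rnd) Γ.flt σ') = i)
    (hR : firstTrue (fun j => (B j).toReal.holds (realModel Ω) Γ.real σ) = i) {w : Float φ}
    (h : w = (S i).eval (floatModel Ω Γ.rnd) Γ.flt σ' ∧ ∃ c ∈ (S i).sem Γ I,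
      c.Tracks Γ (S i).fv σ σ' ((S i).toReal.eval (realModel Ω) Γ.real σ) w) :
    w = (Stm.cond m B S).eval (floatModel Ω Γ.rnd) Γ.flt σ' ∧ ∃ c ∈ (Stm.cond m B S).sem Γ I,
      c.Tracks Γ (Stm.cond m B S).fv σ σ'
        ((Stm.cond m B S).toReal.eval (realModel Ω) Γ.real σ) w := by
  obtain ⟨rfl, c, hc, htr⟩ := h
  have hsubB : ∀ j, (B j).fv ⊆ (Stm.cond m B S).fv := fun j =>
    (Set.subset_iUnion (fun j => (B j).fv) j).trans Set.subset_union_left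
  have hsubS : (S i).fv ⊆ (Stm.cond m B S).fv :=
    (Set.subset_iUnion (fun j => (S j).fv) i).trans Set.subset_union_right
  have hr : (Stm.cond m B S).toReal.eval (realModel Ω) Γ.real σ =
      (S i).toReal.eval (realModel Ω) Γ.real σ := by
    change (S (firstTrue fun j => (B j).toReal.holds (realModel Ω) Γ.real σ)).toReal.eval
      (realModel Ω) Γ.real σ = _
    rw [hR]
  have htr := (htr.mono hsubS).propagate
    (b := (branchCond B i).toReal) (b' := branchCond B i)
    (by
      intro ρ hρ
      rw [BExp.toReal, branchCond_map, holds_branchCond]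
      have hB := fun j => (B j).toReal.holds_congr (realModel Ω) Γ.real
        (hρ.mono ((BExp.fv_map _ (B j)).subset.trans (hsubB j)))
      obtain ⟨h₁, h₂⟩ := (firstTrue_eq_iff _ i).1 hR
      exact ⟨fun h => (hB _).2 (h₁ h), fun j hj => mt (hB j).1 (h₂ j hj)⟩)
    (by
      intro ρ hρ
      rw [holds_branchCond]
      have hB := fun j => (B j).holds_congr (floatModel Ω Γ.rnd) Γ.flt (hρ.mono (hsubB j))
      obtain ⟨h₁, h₂⟩ := (firstTrue_eq_iff _ i).1 hF
      exact ⟨fun h => (hB _).2 (h₁ h), fun j hj => mt (hB j).1 (h₂ j hj)⟩)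
  rw [hr]
  refine ⟨?_, _, Or.inl ⟨i, c, hc, rfl, htr.sat⟩, htr⟩
  simp only [Stm.eval, hF]

theorem TBExp.eval_conj_eq_true {rnd : ℝ → Float φ} {σ : Var → Float φ} {l : List (TBExp Ω)}
    (h : (TBExp.conj l).eval rnd J ε σ = some true) : ∀ b ∈ l, b.eval rnd J ε σ = some true := by
  induction l with
  | nil => simp
  | cons b l ih =>
    simp only [TBExp.conj, TBExp.eval, Option.bind_eq_some_iff, Option.map_eq_some_iff,
      Bool.and_eq_true] at h
    obtain ⟨s, hs, t, ht, rfl, rfl⟩ := h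
    simp only [List.mem_cons, forall_eq_or_imp]
    exact ⟨hs, ih ht⟩

theorem eval_betaBranch_eq_true {rnd : ℝ → Float φ} {σ : Var → Float φ} {m : ℕ}
    {B : Fin (m + 1) → BExp Ω (FConst φ)} {i : Fin (m + 2)}
    (h : (betaBranch T B i).eval rnd J ε σ = some true) :
    (∀ h : (i : ℕ) < m + 1, ((B ⟨i, h⟩).beta T true).eval rnd J ε σ = some true) ∧
      ∀ j : Fin (m + 1), (j : ℕ) < i → ((B j).beta T false).eval rnd J ε σ = some true := by
  simp only [betaBranch, TBExp.eval, Option.bind_eq_some_iff, Option.map_eq_some_iff,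
    Bool.and_eq_true] at h
  obtain ⟨s, hs, t, ht, rfl, rfl⟩ := h
  refine ⟨fun hi => by simpa only [dif_pos hi] using hs, fun j hj => ?_⟩
  exact TBExp.eval_conj_eq_true ht _ (List.mem_map.2 ⟨j, by simpa using hj, rfl⟩)

/-- If the transformed conditional returns no warning, it returns the result of the branch `i` that
both the real and the floating-point flow take. -/
theorem Stm.exists_branch_of_eval_tau {m : ℕ} {B : Fin (m + 1) → BExp Ω (FConst φ)}
    {S : Fin (m + 2) → Stm Ω (FConst φ)} {σ : Var → ℝ} {σ' : Var → Float φ}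
    (hB : ∀ j, ∀ A ∈ (B j).atoms, ∀ w, (A.tau T).eval Γ.rnd J ε σ' = some w →
      w = A.eval (floatModel Ω Γ.rnd) Γ.flt σ')
    (hε : (Stm.cond m B S).errValid Γ T V ε σ σ') {w : Float φ}
    (hw : ((Stm.cond m B S).tau Γ.rnd T).eval Γ.rnd J ε σ' = some w) :
    ∃ i, firstTrue (fun j => (B j).holds (floatModel Ω Γ.rnd) Γ.flt σ') = i ∧
      firstTrue (fun j => (B j).toReal.holds (realModel Ω) Γ.real σ) = i ∧
      ((S i).tau Γ.rnd T).eval Γ.rnd J ε σ' = some w := by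
  rw [Stm.tau] at hw
  split_ifs at hw with hU
  · rw [TExp.eval, Option.bind_eq_some_iff] at hw
    obtain ⟨i, hi, hw⟩ := hw
    obtain ⟨h₁, h₂⟩ := firstTrueO_eq_some hi
    have hiff := fun j => (hU j).holds_iff Γ.flt Γ.real σ' σ
    have hF : firstTrue (fun j => (B j).holds (floatModel Ω Γ.rnd) Γ.flt σ') = i :=
      (firstTrue_eq_iff _ i).2 ⟨fun h => (BExp.eval_lift (hB _) (h₁ h)).1 rfl,
        fun j hj h => by simpa using (BExp.eval_lift (hB _) (h₂ j hj)).2 h⟩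
    refine ⟨i, hF, ?_, hw⟩
    rw [← hF]
    congr 1
    funext j
    exact propext (hiff j).symm
  · rw [TExp.eval, Option.bind_eq_some_iff] at hw
    obtain ⟨k, hk, hw⟩ := hw
    obtain ⟨h₁, -⟩ := firstTrueO_eq_some hk
    induction k using Fin.cases with
    | zero => rw [Fin.cons_zero, TExp.eval] at hw; simp at hw
    | succ k =>
    rw [Fin.cons_succ] at hw
    induction k using Fin.lastCases with
    | last => rw [Fin.snoc_last, TExp.eval] at hw; simp at hw
    | cast i =>
    rw [Fin.snoc_castSucc] at hw
    -- Guard `i + 1` of the transformed conditional is the restricted guard of branch `i`.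
    have hi : (betaBranch T B i).eval Γ.rnd J ε σ' = some true := h₁ (by simp)
    obtain ⟨h₁, h₂⟩ := eval_betaBranch_eq_true hi
    have hbeta := fun j pol => BExp.holds_of_eval_beta (pol := pol) (hB j) (hε.2.1 hU j)
    exact ⟨i, (firstTrue_eq_iff _ i).2 ⟨fun h => (hbeta _ _ (h₁ h)).1.2 rfl,
        fun j hj h => by simpa using (hbeta _ _ (h₂ j hj)).1.1 h⟩,
      (firstTrue_eq_iff _ i).2 ⟨fun h => (hbeta _ _ (h₁ h)).2.2 rfl,
        fun j hj h => by simpa using (hbeta _ _ (h₂ j hj)).2.1 h⟩, hw⟩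

theorem BExp.calls_subset_of_mem_atoms {B : BExp Ω (FConst φ)} {A : AExp Ω (FConst φ)}
    (hA : A ∈ B.atoms) : A.calls ⊆ B.calls := by
  induction B with
  | tt => simp [BExp.atoms] at hA
  | ff => simp [BExp.atoms] at hA
  | and a b iha ihb =>
    rcases List.mem_append.1 hA with h | h
    · exact (iha h).trans Set.subset_union_left
    · exact (ihb h).trans Set.subset_union_right
  | or a b iha ihb =>
    rcases List.mem_append.1 hA with h | h
    · exact (iha h).trans Set.subset_union_left
    · exact (ihb h).trans Set.subset_union_right
  | not a ih => exact ih hA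
  | sign c a =>
    obtain rfl := List.mem_singleton.1 hA
    exact subset_rfl

/-- If a transformed program expression returns no warning, it returns the floating-point value,
and the semantics contains a conditional error bound of this execution. -/
theorem Stm.tracks_of_eval_tau (s : Stm Ω (FConst φ))
    (hJ : ∀ f n, (f, n) ∈ s.calls → FunCorrect Γ I V J f n) {σ : Var → ℝ} {σ' : Var → Float φ}
    (hε : s.errValid Γ T V ε σ σ') {w : Float φ}
    (hw : (s.tau Γ.rnd T).eval Γ.rnd J ε σ' = some w) :
    w = s.eval (floatModel Ω Γ.rnd) Γ.flt σ' ∧ ∃ c ∈ s.sem Γ I,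
      c.Tracks Γ s.fv σ σ' (s.toReal.eval (realModel Ω) Γ.real σ) w := by
  induction s generalizing σ σ' w with
  | arith a => exact a.tracks_of_eval_tau hJ hε hw
  | letIn x a s ih =>
    rw [Stm.tau, TExp.eval_ite, TBExp.eval, Option.bind_some] at hw
    split_ifs at hw with hnone
    · rw [TExp.eval] at hw
      simp at hw
    rw [TExp.eval, Option.bind_eq_some_iff] at hw
    obtain ⟨v, hv, hw⟩ := hw
    obtain ⟨rfl, c₁, hc₁, htr₁⟩ := a.tracks_of_eval_tau (fun f n hf => hJ f n (Or.inl hf)) hε.1 hv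
    obtain ⟨rfl, c₀, hc₀, htr₀⟩ := ih (fun f n hf => hJ f n (Or.inr hf)) hε.2 hw
    have htr₁ : c₁.Tracks Γ (Stm.letIn x a s).fv σ σ' _ _ := htr₁.mono Set.subset_union_left
    have htr := htr₀.apply (X := (Stm.letIn x a s).fv) (σ := σ) (σ' := σ')
      (θ := Function.update CEB.var x c₁) (cs := ![c₁]) (by
        intro y hy
        by_cases hyx : y = x
        · subst hyx
          simpa only [Function.update_self] using htr₁
        · simp only [Function.update_of_ne hyx]
          exact CEB.Tracks.var (Or.inr ⟨hy, hyx⟩) σ σ')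
      (rs := fun _ => _) (vs := fun _ => _) (Fin.forall_fin_one.2 htr₁)
    exact ⟨rfl, _, ⟨c₀, hc₀, c₁, hc₁, rfl, htr.sat⟩, htr⟩
  | cond m B S ih =>
    obtain ⟨i, hF, hR, hw⟩ := Stm.exists_branch_of_eval_tau (fun j A hA w hw =>
      (A.tracks_of_eval_tau (fun f n hf => hJ f n (Or.inl (Set.mem_iUnion_of_mem j
        (BExp.calls_subset_of_mem_atoms hA hf)))) (hε.1 j A hA) hw).1) hε hw
    exact CEB.Tracks.cond hF hR (ih i (fun f n hf =>
      hJ f n (Or.inr (Set.mem_iUnion_of_mem i hf))) (hε.2.2 i) hw)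
  | forLoop i₀ iN acc₀ i acc s ih =>
    rw [Stm.tau, TExp.eval] at hw
    simp only [Stm.errValid] at hε
    simp only [Stm.eval, Stm.sem, Stm.toReal, Stm.map]
    generalize iN + 1 - i₀ = N at hw hε ⊢
    induction N generalizing w with
    | zero =>
      obtain rfl := Option.some.inj hw
      exact ⟨rfl, _, rfl, CEB.Tracks.const acc₀ _ σ σ'⟩
    | succ k ihk =>
      obtain ⟨v, hv, hw⟩ := Option.bind_eq_some_iff.1 hw
      obtain ⟨rfl, c₁, hc₁, htr₁⟩ := ihk hv fun j hj => hε j (hj.trans k.lt_succ_self)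
      obtain ⟨rfl, c₀, hc₀, htr₀⟩ := ih hJ (hε k k.lt_succ_self) hw
      have hidx := CEB.Tracks.const (Γ := Γ) (Ω := Ω)
        (roundConst Γ.rnd ((i₀ + k : ℕ) : ℝ)) (Stm.forLoop i₀ iN acc₀ i acc s).fv σ σ'
      have htr := htr₀.apply (X := (Stm.forLoop i₀ iN acc₀ i acc s).fv) (σ := σ) (σ' := σ')
        (θ := bindLoop CEB.var i acc (CEB.const (roundConst Γ.rnd ((i₀ + k : ℕ) : ℝ))) c₁)
        (cs := ![CEB.const (roundConst Γ.rnd ((i₀ + k : ℕ) : ℝ)), c₁])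
        (rs := ![_, _]) (vs := ![_, _]) (by
          intro y hy
          simp only [bindLoop]
          by_cases hya : y = acc
          · subst hya
            simp only [Function.update_self]
            exact htr₁
          · simp only [Function.update_of_ne hya]
            by_cases hyi : y = i
            · subst hyi
              simp only [Function.update_self]
              exact hidx
            · simp only [Function.update_of_ne hyi]
              exact CEB.Tracks.var (X := (Stm.forLoop i₀ iN acc₀ i acc s).fv)
                ⟨hy, by simp [hya, hyi]⟩ σ σ')
          (by
          rw [Fin.forall_fin_two]
          exact ⟨hidx, htr₁⟩)
      exact ⟨rfl, _, ⟨c₀, hc₀, c₁, hc₁, rfl, htr.sat⟩, htr⟩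

end Soundness

/-! ### Validity of error variables -/

section Validity

variable {φ : Format} {Ω : Ops φ} {Γ Γ' : Ctx Ω} {T : TProgram Ω} {V : ErrCond Ω}
  {ε ε' : ErrVar Ω → Float φ}

/-- The validity of the error variables in an expression only depends on the error variables
introduced by `τ` and on the functions that are called. -/
theorem AExp.errValid_congr (a : AExp Ω (FConst φ)) (hrnd : Γ.rnd = Γ'.rnd)
    (hR : ∀ f n, (f, n) ∈ a.calls → Γ.real f n = Γ'.real f n)
    (hF : ∀ f n, (f, n) ∈ a.calls → Γ.flt f n = Γ'.flt f n)
    (hV : ∀ f n r v δ δ', Set.EqOn δ δ' (formalErrs T f n) → V f n r v δ → V f n r v δ')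
    (hεε : Set.EqOn ε ε' (a.tauVars T)) {σ : Var → ℝ} {σ' : Var → Float φ}
    (h : a.errValid Γ T V ε σ σ') : a.errValid Γ' T V ε' σ σ' := by
  induction a with
  | const c => trivial
  | var x => trivial
  | op o args ih =>
    exact fun i => ih i (fun f n hf => hR f n (Set.mem_iUnion_of_mem i hf))
      (fun f n hf => hF f n (Set.mem_iUnion_of_mem i hf))
      (hεε.mono (Set.subset_iUnion (fun i => (args i).tauVars T) i)) (h i)
  | call f n args ih =>
    have hR' := fun i f n hf => hR f n (Or.inr (Set.mem_iUnion_of_mem i hf))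
    have hF' := fun i f n hf => hF f n (Or.inr (Set.mem_iUnion_of_mem i hf))
    refine ⟨fun i => ih i (hR' i) (hF' i) (hεε.mono
      ((Set.subset_iUnion (fun i => (args i).tauVars T) i).trans Set.subset_union_left)) (h.1 i), ?_⟩
    have h₂ := h.2
    rw [hrnd] at h₂
    simp only [fun i => (args i).eval_congr_interp (floatModel Ω Γ'.rnd) σ' (hF' i),
      fun i => (args i).toReal.eval_congr_interp (realModel Ω) σ
        fun f n hf => hR' i f n ((AExp.calls_map _ (args i)).subset hf)] at h₂
    exact hV _ _ _ _ _ _ (fun A hA => hεε (Or.inr ⟨A, hA, rfl⟩)) h₂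

theorem Stm.errValid_congr (s : Stm Ω (FConst φ)) (hrnd : Γ.rnd = Γ'.rnd)
    (hR : ∀ f n, (f, n) ∈ s.calls → Γ.real f n = Γ'.real f n)
    (hF : ∀ f n, (f, n) ∈ s.calls → Γ.flt f n = Γ'.flt f n)
    (hV : ∀ f n r v δ δ', Set.EqOn δ δ' (formalErrs T f n) → V f n r v δ → V f n r v δ')
    (hεε : Set.EqOn ε ε' (s.tauVars Γ.rnd T)) {σ : Var → ℝ} {σ' : Var → Float φ}
    (h : s.errValid Γ T V ε σ σ') : s.errValid Γ' T V ε' σ σ' := by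
  induction s generalizing σ σ' with
  | arith a => exact a.errValid_congr hrnd hR hF hV hεε h
  | letIn x a s ih =>
    have hRa := fun f n hf => hR f n (Or.inl hf)
    have hFa := fun f n hf => hF f n (Or.inl hf)
    refine ⟨a.errValid_congr hrnd hRa hFa hV (hεε.mono Set.subset_union_left) h.1, ?_⟩
    have h₂ := ih (fun f n hf => hR f n (Or.inr hf)) (fun f n hf => hF f n (Or.inr hf))
      (hεε.mono Set.subset_union_right) h.2
    rwa [hrnd, a.eval_congr_interp _ σ' hFa, a.toReal.eval_congr_interp _ σ
      fun f n hf => hRa f n ((AExp.calls_map _ a).subset hf)] at h₂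
  | cond m B S ih =>
    have hcalls : ∀ j, ∀ A ∈ (B j).atoms, A.calls ⊆ (Stm.cond m B S).calls := fun j A hA _ hf =>
      Or.inl (Set.mem_iUnion_of_mem j (BExp.calls_subset_of_mem_atoms hA hf))
    refine ⟨fun j A hA => ?_, fun hU j A hA => ?_, fun j => ?_⟩
    · exact A.errValid_congr hrnd (fun f n hf => hR f n (hcalls j A hA hf))
        (fun f n hf => hF f n (hcalls j A hA hf)) hV
        (hεε.mono fun _ h => Or.inl (Or.inr ⟨j, A, hA, h⟩)) (h.1 j A hA)
    · rw [← hrnd] at hU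
      have h₂ := h.2.1 hU j A hA
      rwa [hrnd, A.eval_congr_interp _ σ' (fun f n hf => hF f n (hcalls j A hA hf)),
        A.toReal.eval_congr_interp _ σ (fun f n hf =>
          hR f n (hcalls j A hA ((AExp.calls_map _ A).subset hf))),
        hεε (Or.inr ⟨hU, j, hA⟩)] at h₂
    · exact ih j (fun f n hf => hR f n (Or.inr (Set.mem_iUnion_of_mem j hf)))
        (fun f n hf => hF f n (Or.inr (Set.mem_iUnion_of_mem j hf)))
        (hεε.mono fun _ h => Or.inl (Or.inl (Set.mem_iUnion_of_mem j h))) (h.2.2 j)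
  | forLoop i₀ iN acc₀ i acc s ih =>
    intro k hk
    have h₂ := ih hR hF hεε (h k hk)
    rwa [s.eval_congr_interp _ hF, s.toReal.eval_congr_interp _
      fun f n hf => hR f n ((Stm.calls_map _ s).subset hf), hrnd] at h₂

theorem errValid_congr (rnd : ℝ → Float φ) (P : Program Ω (FConst φ)) (f : FName) (n : ℕ)
    (r : Fin n → ℝ) (v : Fin n → Float φ) (δ δ' : ErrVar Ω → Float φ)
    (hδ : Set.EqOn δ δ' (formalErrs (tauProgram rnd P) f n)) (h : errValid rnd P f n r v δ) :
    errValid rnd P f n r v δ' := by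
  induction P generalizing f n r v δ δ' with
  | nil => trivial
  | cons d P ih =>
    rw [errValid] at h ⊢
    rw [tauProgram, formalErrs] at hδ
    split_ifs at h hδ ⊢ with hd
    · exact d.body.errValid_congr rfl (fun _ _ _ => rfl) (fun _ _ _ => rfl)
        ih hδ h
    · exact ih f n r v δ δ' hδ h

end Validity

/-! ### Soundness of the transformation of programs -/

section Programs

variable {φ : Format} {Ω : Ops φ}

open Classical in
/-- Correctness of the transformed functions, from the first declaration to the last one. -/
theorem funCorrect_runT {rnd : ℝ → Float φ} {P Q : Program Ω (FConst φ)} (hP : WellFormed P)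
    (hQ : Q <:+ P) {f : FName} {n : ℕ} (hf : (f, n) ∈ declared Q) :
    FunCorrect (ctxOf rnd P) (progSem rnd P) (errValid rnd Q) (runT rnd (tauProgram rnd Q)) f n := by
  induction Q generalizing f n with
  | nil => simp [declared] at hf
  | cons d Q ih =>
    have hQ' := (List.suffix_cons d Q).trans hQ
    intro a v ε w hV hw
    rw [errValid] at hV
    rw [tauProgram, runT] at hw
    split_ifs at hV hw with hd
    · obtain ⟨rfl, rfl⟩ := hd
      have hcalls := (hP.of_suffix hQ).2.2.1
      have hsuf : toReal Q <:+ toReal P := hQ'.map _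
      have hsuf' : d.map FConst.real :: toReal Q <:+ toReal P := hQ.map (Decl.map FConst.real)
      have hP' : WellFormed (toReal P) := hP.map _
      -- The body only sees its own error parameters, and its validity only depends on them.
      have hV' := d.body.errValid_congr (Γ := ctxOf rnd Q) (Γ' := ctxOf rnd P)
        (ε' := fun A => if A ∈ d.body.tauVars rnd (tauProgram rnd Q) then ε A else Float.zero φ)
        rfl
        (fun f n hf => (interp_suffix _ hP' hsuf
          ((declared_map _ Q).superset (hcalls hf))).symm)
        (fun f n hf => (interp_suffix _ hP hQ' (hcalls hf)).symm)
        (errValid_congr rnd Q) (fun A hA => (if_pos hA).symm) hV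
      obtain ⟨hw, c, hc, htr⟩ := d.body.tracks_of_eval_tau (Γ := ctxOf rnd P)
        (I := progSem rnd P) (fun f n hf => ih hQ' (hcalls hf)) hV' hw
      have hreal : (ctxOf rnd P).real d.name d.arity a = _ :=
        interp_decl (realModel Ω) hP' hsuf' a fun _ => 0
      refine ⟨hw.trans (interp_decl (floatModel Ω rnd) hP hQ v fun _ => Float.zero φ).symm,
        d.params, d.params_inj, c,
        body_sem_subset_progSem rnd (hQ.subset List.mem_cons_self) hc, fun τ τ' hτ hτ' => ?_⟩
      rw [hreal]
      exact (htr.mono (hP.of_suffix hQ).2.1).congr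
        (by rintro _ ⟨i, rfl⟩; rw [hτ, assign_apply d.params_inj]; rfl)
        (by rintro _ ⟨i, rfl⟩; rw [hτ', assign_apply d.params_inj]; rfl)
    · have hf' : (f, n) ∈ declared Q := by
        obtain ⟨d', hd', h⟩ := hf
        rcases List.mem_cons.1 hd' with rfl | hd'
        · exact absurd ⟨(Prod.mk.inj h).1.symm, (Prod.mk.inj h).2.symm⟩ hd
        · exact ⟨d', hd', h⟩
      exact ih hQ' hf' a v ε w hV hw

/-- The stable errors of a function have a maximum as soon as one of them exists. -/
theorem exists_isGreatest_stableErrors {rnd : ℝ → Float φ} {P : Program Ω (FConst φ)}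
    (hP : WellFormed P) {d : Decl Ω (FConst φ)} (hd : d ∈ P) {a ea : Fin d.arity → ℝ}
    (h : (stableErrors rnd P d a ea).Nonempty) :
    ∃ e, IsGreatest (stableErrors rnd P d a ea) e := by
  have hfin := progSem_finite rnd hP (List.suffix_refl P) (f := d.name) (n := d.arity) ⟨d, hd, rfl⟩
  have hfin : (stableErrors rnd P d a ea).Finite := by
    refine (hfin.image fun p => p.2.err.eval (ctxOf rnd P).real (assign d.params a fun _ => 0)
      (assign d.params ea fun _ => 0)).subset ?_
    rintro e ⟨c, hc, -, rfl⟩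
    exact ⟨(d.params, c), hc, rfl⟩
  exact ⟨_, hfin.isCompact.isGreatest_sSup h⟩

end Programs

end FPTrans

theorem mainTheorem5 {φ : FPTrans.Format} (Ω : FPTrans.Ops φ)
    (rnd : ℝ → FPTrans.Float φ) (hrnd : FPTrans.IsRounding rnd)
    (P : FPTrans.Program Ω ℝ) (hP : FPTrans.WellFormed P)
    (d : FPTrans.Decl Ω ℝ) (hd : d ∈ P)
    (σ : Fin d.arity → ℝ) (σ' : Fin d.arity → FPTrans.Float φ)
    (hσ : ∀ i, (σ' i).toReal = σ i)
    (χ : Fin d.arity → ℝ) (hχ : ∀ i, |(σ' i).toReal - σ i| ≤ χ i)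
    (ε : FPTrans.ErrVar Ω → FPTrans.Float φ)
    (hε : FPTrans.errValid rnd (FPTrans.toFloat rnd P) d.name d.arity σ σ' ε) :
    FPTrans.runT rnd (FPTrans.transform rnd P) d.name d.arity σ' ε ≠ none ↔
      ∃ e, IsGreatest (FPTrans.stableErrors rnd (FPTrans.toFloat rnd P)
            (d.map (FPTrans.roundConst rnd)) σ χ) e ∧
          FPTrans.diffLe (FPTrans.interp (FPTrans.realModel Ω) P d.name d.arity σ)
            (FPTrans.runT rnd (FPTrans.transform rnd P) d.name d.arity σ' ε) e := by
  open FPTrans in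
  constructor
  · intro hne
    obtain ⟨w, hw⟩ := Option.ne_none_iff_exists'.1 hne
    have hPf : WellFormed (toFloat rnd P) := hP.map _
    have hdf : d.map (roundConst rnd) ∈ toFloat rnd P := List.mem_map_of_mem hd
    obtain ⟨-, xs, -, c, hc, htr⟩ := funCorrect_runT (rnd := rnd) hPf (List.suffix_refl _)
      ⟨d.map (roundConst rnd), hdf, rfl⟩ σ σ' ε w hε hw
    obtain rfl : xs = d.params := by
      rw [← progSem_eq] at hc
      obtain ⟨d', hd', hn, ha, hx, -⟩ := hc
      obtain rfl := hPf.eq_of_mem hd' hdf hn ha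
      exact funext hx
    have hreal : (ctxOf rnd (toFloat rnd P)).real = interp (realModel Ω) P := by
      simp only [ctxOf, toReal_toFloat]
    have htr := htr (assign d.params σ fun _ => 0) (assign d.params σ' fun _ => Float.zero φ)
      (assign_apply d.params_inj _ _) (assign_apply d.params_inj _ _)
    have hle := htr.err _ (assign d.params χ fun _ => 0) (fun _ _ => rfl) (by
      rintro _ ⟨i, rfl⟩
      have h := hχ i
      rw [← assign_apply d.params_inj σ' (fun _ => Float.zero φ) i,
        ← assign_apply d.params_inj σ (fun _ => 0) i,
        ← assign_apply d.params_inj χ (fun _ => 0) i] at h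
      exact h)
    have hmem : _ ∈ stableErrors rnd (toFloat rnd P) (d.map (roundConst rnd)) σ χ :=
      ⟨c, hc, htr.stable, rfl⟩
    obtain ⟨e, he⟩ := exists_isGreatest_stableErrors hPf hdf ⟨_, hmem⟩
    refine ⟨e, he, w, hw, ?_⟩
    rw [abs_sub_comm, ← hreal]
    exact hle.trans (he.2 hmem)
  · rintro ⟨e, -, v, hv, -⟩
    exact fun h => by simp [h] at hv
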